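/- Let $n, r \ge 1$ be integers, let $G \le S_n$ be a transitive permutation group of degree $n$, and let $G$ act on $(\mathbb{A}^n)^r$ diagonally, by permuting the $n$ coordinates in each copy of $\mathbb{A}^n$. Let $\mathcal{I} = \{f_1,\dots,f_{nr}\}$ be a set of $nr$ algebraically independent $G$-invariant polynomials on $(\mathbb{A}^n)^r$ with coefficients in $\mathbb{Z}$. Put $\deg\mathcal{I} := \sum_{i=1}^{nr} \deg f_i$ (total degrees) and $\mathcal{I}(1) := \prod_{i=1}^{nr} |f_i|(1)$, where $|f_i|$ is obtained from $f_i$ by replacing each coefficient by its absolute value and $|f_i|(1)$ is its value at $(1,\dots,1)$. For a number field $k$, with a fixed algebraic closure $\overline{k}$, and $X \ge 1$, let $\mathcal{F}_{n,k}(X;G)$ be the set of extensions $K/k$ inside $\overline{k}$ such that $[K:k]=n$, the absolute discriminant satisfies $|\mathrm{Disc}(K)| \le X$, and $\mathrm{Gal}(\widetilde{K}/k)$, viewed as a permutation group through its action on the $n$ $k$-embeddings of $K$ into its normal closure $\widetilde{K}$ over $k$, is isomorphic to $G$ as a permutation group. For a number field $K$ of degree $m$ over $\mathbb{Q}$ and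 $\alpha\in\mathcal{O}_K$, let $\|\alpha\| := \max_{v\mid\infty} |\alpha|_v$, and let $\lambda_{\max}(K)$ be the largest Minkowski successive minimum of $\mathcal{O}_K$, that is, the smallest $\lambda$ such that $\{\alpha\in\mathcal{O}_K : \|\alpha\|\le\lambda\}$ spans a $\mathbb{Q}$-vector space of dimension $m$. Then for every number field $k$ and every $X \ge 1$, the set $\mathcal{F}_{n,k}(X;G)$ is finite and $$\#\mathcal{F}_{n,k}(X;G) \ll_{n,[k:\mathbb{Q}],r,\mathcal{I}} X^{\frac{1}{n}\deg\mathcal{I}-\frac{r}{2}}\, |\mathrm{Disc}(k)|^{-\frac{nr}{2}}.$$ More explicitly, if $d=[k:\mathbb{Q}]$ and $$C := (2\pi)^{dnr}\, d!^{\,nr}\, \mathcal{I}(1)^d \left(2dn\left(\deg\mathcal{I}+\binom{n}{2}\right)\right)^{d\deg\mathcal{I}},$$ then for all $X,\lambda\ge 1$, $$\#\{K\in\mathcal{F}_{n,k}(X;G) : \lambda_{\max}(K)\le\lambda\} \le C\cdot \frac{\lambda^{d\deg\mathcal{I}-dnr}\, X^{\frac{r}{2}}}{|\mathrm{Disc}(k)|^{nr/2}},$$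 and $$\#\mathcal{F}_{n,k}(X;G) \le C\cdot \frac{X^{\frac{1}{n}\deg\mathcal{I}-\frac{r}{2}}}{|\mathrm{Disc}(k)|^{rn/2}}.$$ -/

import Mathlib

open scoped NumberField

noncomputable section

namespace InvariantBound

/-- The diagonal action of a permutation of the `n` coordinates of `𝔸ⁿ` on polynomials on
`(𝔸ⁿ)ʳ`; the variable `(j, i)` is the `i`-th coordinate on the `j`-th copy of `𝔸ⁿ`. -/
def permute {n r : ℕ} (σ : Equiv.Perm (Fin n)) (f : MvPolynomial (Fin r × Fin n) ℤ) :
    MvPolynomial (Fin r × Fin n) ℤ :=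
  MvPolynomial.rename (fun x => (x.1, σ x.2)) f

/-- `f` is invariant under the diagonal action of `G` on `(𝔸ⁿ)ʳ`. -/
def IsInvariant {n r : ℕ} (G : Subgroup (Equiv.Perm (Fin n)))
    (f : MvPolynomial (Fin r × Fin n) ℤ) : Prop :=
  ∀ σ ∈ G, permute σ f = f

/-- The polynomial `|f|`: every coefficient is replaced by its absolute value. -/
def absPoly {τ : Type*} (f : MvPolynomial τ ℤ) : MvPolynomial τ ℤ :=
  ∑ m ∈ f.support, MvPolynomial.monomial m |f.coeff m|

/-- `𝓘(1) = ∏ᵢ |fᵢ|(1)`. -/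
def evalOne {τ ι : Type*} [Fintype ι] (f : ι → MvPolynomial τ ℤ) : ℤ :=
  ∏ i, MvPolynomial.eval (fun _ => (1 : ℤ)) (absPoly (f i))

/-- `deg 𝓘 = ∑ᵢ deg fᵢ`. -/
def degSum {τ ι : Type*} [Fintype ι] (f : ι → MvPolynomial τ ℤ) : ℕ :=
  ∑ i, (f i).totalDegree

/-- The `i`-th Minkowski successive minimum of `𝓞 K`: the smallest `t` such that the integers
`α` with `‖α‖ ≤ t` span a space of dimension at least `i`. Here `‖α‖`, the maximum of `|α|_v` over
the archimedean places `v`, is Mathlib's `NumberField.house`. -/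
def successiveMinimum (K : Type*) [Field K] [NumberField K] (i : ℕ) : ℝ :=
  sInf {t : ℝ | 0 ≤ t ∧ i ≤ Module.finrank ℚ
    (Submodule.span ℚ ((fun a : 𝓞 K => (a : K)) '' {a : 𝓞 K | NumberField.house (a : K) ≤ t}))}

/-- The largest successive minimum of `𝓞 K`. -/
def lambdaMax (K : Type*) [Field K] [NumberField K] : ℝ :=
  successiveMinimum K (Module.finrank ℚ K)

/-- The Galois group of the normal closure of `K` over `k`, as a permutation group through its
action on the `k`-embeddings of `K`, is isomorphic to the permutation group `G`. -/
def HasGaloisGroup {k Ω : Type*} [Field k] [Field Ω] [Algebra k Ω] {n : ℕ}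
    (G : Subgroup (Equiv.Perm (Fin n))) (K : IntermediateField k Ω) : Prop :=
  ∃ (e : (K →ₐ[k] IntermediateField.normalClosure k K Ω) ≃ Fin n)
    (φ : (IntermediateField.normalClosure k K Ω ≃ₐ[k] IntermediateField.normalClosure k K Ω) ≃* G),
    ∀ (σ : IntermediateField.normalClosure k K Ω ≃ₐ[k] IntermediateField.normalClosure k K Ω)
      (τ : K →ₐ[k] IntermediateField.normalClosure k K Ω),
      e (σ.toAlgHom.comp τ) = (φ σ : Equiv.Perm (Fin n)) (e τ)

/-- `𝓕_{n,k}(X; G)`: the extensions `K/k` of degree `n` inside the algebraic closure `Ω` of `k`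
with Galois group `G` and absolute discriminant at most `X` in absolute value. -/
def extensions (k Ω : Type*) [Field k] [Field Ω] [Algebra k Ω] {n : ℕ}
    (G : Subgroup (Equiv.Perm (Fin n))) (X : ℝ) : Set (IntermediateField k Ω) :=
  {K | Module.finrank k K = n ∧ HasGaloisGroup G K ∧
    ∃ _ : NumberField K, ((|NumberField.discr K| : ℤ) : ℝ) ≤ X}

/-- The fields `K` in `𝓕_{n,k}(X; G)` with `λ_max(K) ≤ l`. -/
def extensionsMinimaLE (k Ω : Type*) [Field k] [Field Ω] [Algebra k Ω] {n : ℕ}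
    (G : Subgroup (Equiv.Perm (Fin n))) (X l : ℝ) : Set (IntermediateField k Ω) :=
  {K | K ∈ extensions k Ω G X ∧ ∃ _ : NumberField K, lambdaMax K ≤ l}

/-- `(2π)^{dnr} d!^{nr} 𝓘(1)^d (2dn (deg 𝓘 + (n choose 2)))^{d deg 𝓘}`. -/
def explicitConst (n r d : ℕ) (f : Fin (n * r) → MvPolynomial (Fin r × Fin n) ℤ) : ℝ :=
  (2 * Real.pi) ^ (d * n * r) * (d.factorial : ℝ) ^ (n * r) * (evalOne f : ℝ) ^ d *
    (2 * d * n * ((degSum f : ℝ) + (n.choose 2 : ℝ))) ^ (d * degSum f)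

end InvariantBound

end

open scoped NumberField

noncomputable section

namespace InvariantBound

/-! Fields are counted through points. For an admissible `K`, a tuple in `(𝓞 K)^r` has a conjugate
vector in `(𝔸ⁿ)ʳ`, at which every invariant takes a value in `𝓞 k`: the Galois group permutes the
coordinates through `G`. If the house of the tuple is at most `H`, the value of `f_i` has house at
most `|f_i|(1) H^(deg f_i)`.

Upper bound: where the Jacobian of the `f_i` does not vanish, at most `∏ deg f_i` points share given
values (`card_nondegenerate_zeros_le`). The value vectors lie in boxes of `𝓞 k`, whose lattice
points are counted by `card_mul_sqrt_discr_le`; this produces the power of `|Disc k|` in the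
denominator.

Lower bound: `exists_finset_points` gives each `K` at least a constant times `(l^(dn) / √|Disc
K|)^r` points. Starting from all tuples in a box, each one is moved by a small integral combination
of a short basis to leave the zero locus of the Jacobian times a Vandermonde factor; the Jacobian is
nonzero by `det_pderiv_ne_zero`. The Vandermonde factor makes one coordinate a generator of `K`, so
different fields have disjoint sets of points. Dividing the upper bound by the lower bound proves
the estimate for `λ_max(K) ≤ l`.

The second estimate takes `l = X^(1/(dn))`, which is allowed since `λ_max(K)^(dn) ≤ |Disc K|`
(`lambdaMax_pow_le_discr`). That follows from Minkowski's second theorem, `∏ λ_i ≤ √|Disc K|`,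
together with `λ_max^(dn) ≤ (∏ λ_i)^2`, which comes from multiplication in `K`. -/

open MeasureTheory Module Submodule Set

/-! ### Minkowski's second theorem -/

section GeometryOfNumbers

variable {E : Type*} [NormedAddCommGroup E] [NormedSpace ℝ E] [FiniteDimensional ℝ E]

/-- The map that multiplies by `θ` along `V` and is the identity along a complement. -/
theorem det_id_sub_smul_projection {V W : Submodule ℝ E} (h : IsCompl V W) (θ : ℝ) :
    LinearMap.det (LinearMap.id - (1 - θ) • V.projection W h) = θ ^ finrank ℝ V := by
  have key : LinearMap.id - (1 - θ) • V.projection W h =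
      (V.prodEquivOfIsCompl W h : (V × W) →ₗ[ℝ] E) ∘ₗ
        (LinearMap.prodMap (θ • LinearMap.id) LinearMap.id) ∘ₗ
          ((V.prodEquivOfIsCompl W h).symm : E →ₗ[ℝ] V × W) := by
    ext x
    obtain ⟨⟨v, w⟩, rfl⟩ := (V.prodEquivOfIsCompl W h).surjective x
    rw [LinearMap.comp_apply, LinearMap.comp_apply, LinearEquiv.coe_coe, LinearEquiv.coe_coe,
      LinearEquiv.symm_apply_apply]
    simp only [coe_prodEquivOfIsCompl', LinearMap.sub_apply, LinearMap.smul_apply, map_add,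
      projection_apply_left, LinearMap.prodMap_apply, LinearMap.id_apply,
      projection_apply_right, Submodule.coe_smul]
    module
  rw [key, LinearMap.det_conj, LinearMap.det_prodMap]
  simp

variable [MeasurableSpace E] [BorelSpace E]

/-- Squeezing a subset of an open convex set by a factor `θ` along the cosets of a subspace. -/
theorem exists_squeeze (μ : Measure E) [μ.IsAddHaarMeasure] {K A : Set E} (hKc : Convex ℝ K)
    (hKo : IsOpen K) (hA : MeasurableSet A) (hAK : A ⊆ K) (V : Submodule ℝ E) {θ : ℝ}
    (h0 : 0 < θ) (h1 : θ ≤ 1) :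
    ∃ A' ⊆ K, MeasurableSet A' ∧ μ A' = ENNReal.ofReal (θ ^ finrank ℝ V) * μ A ∧
      ∀ x ∈ A', ∀ y ∈ A', x - y ∈ V → ∃ a ∈ A, ∃ b ∈ A, x - y = θ • (a - b) := by
  obtain ⟨W, hW⟩ := V.exists_isCompl
  set π := V.projection W hW
  have hπV : ∀ v ∈ V, π v = v := fun v hv => projection_apply_of_mem_left hW hv
  have hππ : ∀ x, π (π x) = π x := fun x => hπV _ (projection_apply_mem hW x)
  have hπc : Continuous π := π.continuous_of_finiteDimensional
  set S : E →ₗ[ℝ] E := LinearMap.id - (1 - θ) • π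
  have hSdet : LinearMap.det S = θ ^ finrank ℝ V := det_id_sub_smul_projection hW θ
  have hSx : ∀ x, S x = x - (1 - θ) • π x := fun x => rfl
  have hdet0 : LinearMap.det S ≠ 0 := by rw [hSdet]; positivity
  -- Countably many candidate centres: as `K` is open, each coset of `V` that meets `K` has some `w
  -- + q j` in `K`, where `w` is its component in `W`. Taking the least such `j` cuts `A` into
  -- measurable pieces `D j`.
  let q : ℕ → V := TopologicalSpace.denseSeq V
  let U : ℕ → Set E := fun j => {w | w + q j ∈ K}
  have hUm : ∀ j, MeasurableSet (U j) := fun j =>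
    (hKo.preimage (continuous_id.add continuous_const)).measurableSet
  let D : ℕ → Set E := fun j => (fun x => x - π x) ⁻¹' disjointed U j
  have hDm : ∀ j, MeasurableSet (D j) := fun j =>
    (MeasurableSet.disjointed hUm j).preimage (continuous_id.sub hπc).measurable
  have hDdisj : ∀ i j x y, x ∈ D i → y ∈ D j → x - π x = y - π y → i = j := by
    intro i j x y hx hy hxy
    by_contra hne
    refine Set.disjoint_left.1 (disjoint_disjointed U hne) hx ?_
    have hy' : y - π y ∈ disjointed U j := hy
    rwa [← hxy] at hy'
  have hAD : A ⊆ ⋃ j, D j := by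
    intro x hx
    have : x - π x ∈ ⋃ j, U j := by
      have ho : IsOpen {v : V | x - π x + v ∈ K} :=
        hKo.preimage (continuous_const.add continuous_subtype_val)
      have hne : {v : V | x - π x + v ∈ K}.Nonempty :=
        ⟨⟨π x, projection_apply_mem hW x⟩, by simpa using hAK hx⟩
      obtain ⟨j, hv⟩ := (TopologicalSpace.denseRange_denseSeq V).exists_mem_open ho hne
      exact mem_iUnion.2 ⟨j, hv⟩
    rw [← iUnion_disjointed] at this
    obtain ⟨j, hj⟩ := mem_iUnion.1 this
    exact mem_iUnion.2 ⟨j, hj⟩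
  -- On `D j` this is the contraction by `θ` towards the point `x - π x + q j` of `K`. It preserves
  -- the `W`-component, so the images of different pieces stay disjoint.
  let T : ℕ → E → E := fun j x => (1 - θ) • (q j : E) + S x
  have hTw : ∀ j x, T j x - π (T j x) = x - π x := by
    intro j x
    simp only [T, hSx, map_add, map_sub, map_smul, hππ, hπV _ (q j).2]
    module
  let A' : ℕ → Set E := fun j => T j '' (A ∩ D j)
  have himg : ∀ j (s : Set E), T j '' s = (fun x => (1 - θ) • (q j : E) + x) '' (S '' s) :=
    fun j s => by rw [image_image]
  have hA'm : ∀ j, MeasurableSet (A' j) := by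
    intro j
    simp only [A', himg]
    let g := (S.equivOfDetNeZero hdet0).toContinuousLinearEquiv
    have : MeasurableSet (g '' (A ∩ D j)) :=
      g.toHomeomorph.toMeasurableEquiv.measurableSet_image.2 (hA.inter (hDm j))
    exact (Homeomorph.addLeft ((1 - θ) • (q j : E))).toMeasurableEquiv.measurableSet_image.2 this
  refine ⟨⋃ j, A' j, ?_, ?_, ?_, ?_⟩
  · refine iUnion_subset fun j => ?_
    rintro _ ⟨x, ⟨hxA, hxD⟩, rfl⟩
    have hxU : x - π x + q j ∈ K := disjointed_subset U j hxD
    have : T j x = θ • x + (1 - θ) • (x - π x + q j) := by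
      simp only [T, hSx]; module
    rw [this]
    exact hKc (hAK hxA) hxU h0.le (by linarith) (by ring)
  · exact MeasurableSet.iUnion hA'm
  · rw [measure_iUnion]
    · have : ∀ j, μ (A' j) = ENNReal.ofReal (θ ^ finrank ℝ V) * μ (A ∩ D j) := by
        intro j
        simp only [A', himg]
        rw [image_add_left, measure_preimage_add, Measure.addHaar_image_linearMap, hSdet,
          abs_of_nonneg (by positivity)]
      simp_rw [this, ENNReal.tsum_mul_left]
      congr 1
      rw [← measure_iUnion, ← inter_iUnion, inter_eq_left.2 hAD]
      · intro i j hij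
        refine Set.disjoint_left.2 fun x hx hy => hij (hDdisj i j x x hx.2 hy.2 rfl)
      · exact fun j => hA.inter (hDm j)
    · intro i j hij
      refine Set.disjoint_left.2 ?_
      rintro _ ⟨x, hx, rfl⟩ ⟨y, hy, hxy⟩
      exact hij (hDdisj i j x y hx.2 hy.2 (by rw [← hTw i x, ← hTw j y, hxy]))
    · exact hA'm
  · intro x hx y hy hxy
    obtain ⟨i, a, ha, rfl⟩ := mem_iUnion.1 hx
    obtain ⟨j, b, hb, rfl⟩ := mem_iUnion.1 hy
    have hab : a - π a = b - π b := by
      have h := hπV _ hxy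
      rw [map_sub] at h
      rw [← hTw i a, ← hTw j b, ← sub_eq_zero]
      rw [← sub_eq_zero] at h
      rw [← neg_eq_zero, ← h]
      abel
    obtain rfl := hDdisj i j a b ha.2 hb.2 hab
    refine ⟨a, ha.1, b, hb.1, ?_⟩
    simp only [T, hSx]
    have h2 : π a - π b = a - b := by
      rw [sub_eq_sub_iff_add_eq_add] at hab ⊢
      rw [add_comm, ← hab, add_comm]
    have h3 : (1 - θ) • (π a - π b) = (1 - θ) • (a - b) := by rw [h2]
    rw [smul_sub] at h3
    calc _ = (a - b) - ((1 - θ) • π a - (1 - θ) • π b) := by abel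
      _ = _ := by rw [h3]; module

/-- **Minkowski's second theorem**. The `i`-th successive minimum is at least `l i` if the lattice
points of norm less than `l i` lie in a subspace `V i` of dimension at most `i`. -/
theorem prod_mul_measure_ball_le (μ : Measure E) [μ.IsAddHaarMeasure] {L : AddSubgroup E}
    [Countable L] {F : Set E} (hF : IsAddFundamentalDomain L F μ) (hd : 0 < finrank ℝ E)
    (l : ℕ → ℝ) (hl0 : ∀ i, 0 < l i) (hl : Monotone l) (V : ℕ → Submodule ℝ E)
    (hV : Monotone V) (hV0 : V 0 = ⊥) (hVd : ∀ i, finrank ℝ (V i) ≤ i)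
    (hVtop : V (finrank ℝ E) = ⊤)
    (h : ∀ i < finrank ℝ E, ∀ x ∈ L, ‖x‖ < l i → x ∈ V i) :
    ENNReal.ofReal (∏ i ∈ Finset.range (finrank ℝ E), l i) * μ (Metric.ball 0 (1 / 2)) ≤ μ F := by
  obtain ⟨m, hm⟩ : ∃ m, finrank ℝ E = m + 1 := ⟨finrank ℝ E - 1, by omega⟩
  set K : Set E := Metric.ball 0 (l m / 2) with hK
  have hKdiff : ∀ x ∈ K, ∀ y ∈ K, ‖x - y‖ < l m := by
    intro x hx y hy
    rw [hK, mem_ball_zero_iff] at hx hy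
    linarith [norm_sub_le x y]
  -- Stage `j + 1` squeezes stage `j` along `V (j + 1)` by `l j / l (j + 1)`. At `j = m` the factor
  -- `l m / l j` disappears, and differences inside `V (i + 1)` are shorter than `l i` for every
  -- `i`.
  have key : ∀ j ≤ m, ∃ A ⊆ K, MeasurableSet A ∧
      ENNReal.ofReal ((∏ i ∈ Finset.range j, l i) / l j ^ j) * μ K ≤ μ A ∧
      ∀ i ≤ j, ∀ x ∈ A, ∀ y ∈ A, x - y ∈ V (i + 1) → ‖x - y‖ < l i * l m / l j := by
    intro j
    induction j with
    | zero =>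
      intro _
      refine ⟨K, subset_rfl, Metric.isOpen_ball.measurableSet, by simp, ?_⟩
      intro i hi x hx y hy _
      obtain rfl : i = 0 := by omega
      rw [mul_div_cancel_left₀ _ (hl0 0).ne']
      exact hKdiff x hx y hy
    | succ j ih =>
      intro hj
      obtain ⟨A, hAK, hAm, hAμ, hA⟩ := ih (by omega)
      have hθ0 : 0 < l j / l (j + 1) := div_pos (hl0 _) (hl0 _)
      have hθ1 : l j / l (j + 1) ≤ 1 := (div_le_one (hl0 _)).2 (hl (by omega))
      obtain ⟨A', hA'K, hA'm, hA'μ, hA'⟩ := exists_squeeze μ (convex_ball 0 (l m / 2))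
        Metric.isOpen_ball hAm hAK (V (j + 1)) hθ0 hθ1
      refine ⟨A', hA'K, hA'm, ?_, ?_⟩
      · rw [hA'μ]
        calc ENNReal.ofReal ((∏ i ∈ Finset.range (j + 1), l i) / l (j + 1) ^ (j + 1)) * μ K
            = ENNReal.ofReal ((l j / l (j + 1)) ^ (j + 1)) *
                (ENNReal.ofReal ((∏ i ∈ Finset.range j, l i) / l j ^ j) * μ K) := by
              rw [← mul_assoc, ← ENNReal.ofReal_mul (by positivity)]
              congr 2
              have h1 := (hl0 j).ne'
              have h2 := (hl0 (j + 1)).ne'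
              rw [Finset.prod_range_succ, div_pow]
              field_simp
              ring
          _ ≤ _ := by
              gcongr ?_ * ?_
              -- A space `V (j + 1)` of smaller dimension only loses less volume, because the factor
              -- is at most `1`.
              exact ENNReal.ofReal_le_ofReal (pow_le_pow_of_le_one hθ0.le hθ1 (hVd _))
      · intro i hi x hx y hy hxy
        rcases Nat.lt_or_ge j i with hij | hij
        · obtain rfl : i = j + 1 := by omega
          rw [mul_div_cancel_left₀ _ (hl0 _).ne']
          exact hKdiff x (hA'K hx) y (hA'K hy)
        · obtain ⟨a, ha, b, hb, hab⟩ := hA' x hx y hy (hV (by omega) hxy)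
          have hmem : a - b ∈ V (i + 1) := by
            rw [hab] at hxy
            exact ((V (i + 1)).smul_mem_iff hθ0.ne').1 hxy
          have := hA i hij a ha b hb hmem
          rw [hab, norm_smul, Real.norm_of_nonneg hθ0.le]
          calc l j / l (j + 1) * ‖a - b‖ < l j / l (j + 1) * (l i * l m / l j) := by gcongr
            _ = _ := by have h1 := (hl0 j).ne'; field_simp
  obtain ⟨A, hAK, hAm, hAμ, hA⟩ := key m le_rfl
  have hvol : ENNReal.ofReal (∏ i ∈ Finset.range (finrank ℝ E), l i) *
      μ (Metric.ball 0 (1 / 2)) ≤ μ A := by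
    refine le_trans (le_of_eq ?_) hAμ
    have hKeq : K = Metric.ball 0 (l m * (1 / 2)) := by rw [hK]; ring_nf
    rw [hKeq, Measure.addHaar_ball_mul_of_pos μ _ (hl0 m), hm, ← mul_assoc,
      ← ENNReal.ofReal_mul (div_nonneg (Finset.prod_nonneg fun i _ => (hl0 i).le)
        (pow_nonneg (hl0 m).le _))]
    congr 2
    have h1 := (hl0 m).ne'
    rw [Finset.prod_range_succ]
    field_simp
    ring
  refine hvol.trans ?_
  -- If `A` had more volume than `F`, two of its points would differ by a nonzero lattice vector.
  -- Lying in `V (i + 1)` it is shorter than `l i`, hence lies in `V i`; the descent ends in `V 0 =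
  -- ⊥`.
  by_contra! hlt
  obtain ⟨x, y, hxy, hdis⟩ := exists_pair_mem_lattice_not_disjoint_vadd hF
    hAm.nullMeasurableSet hlt
  obtain ⟨_, ⟨a, ha, rfl⟩, ⟨b, hb, hab⟩⟩ := Set.not_disjoint_iff.1 hdis
  have hab' : a - b = ((y - x : L) : E) := by
    have : (y : E) + b = x + a := hab
    rw [AddSubgroup.coe_sub, sub_eq_sub_iff_add_eq_add, add_comm a, ← this, add_comm]
  have hall : ∀ i ≤ finrank ℝ E, a - b ∈ V (finrank ℝ E - i) := by
    intro i
    induction i with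
    | zero => intro _; rw [Nat.sub_zero, hVtop]; trivial
    | succ i ih =>
      intro hi
      have h1 := ih (by omega)
      rw [show finrank ℝ E - i = (finrank ℝ E - (i + 1)) + 1 by omega] at h1
      have h2 := hA (finrank ℝ E - (i + 1)) (by omega) a ha b hb h1
      rw [mul_div_cancel_right₀ _ (hl0 m).ne'] at h2
      exact h _ (by omega) _ (by rw [hab']; exact (y - x).2) h2
  have h0 := hall _ le_rfl
  rw [Nat.sub_self, hV0, Submodule.mem_bot, hab', ZeroMemClass.coe_eq_zero, sub_eq_zero] at h0
  exact hxy h0.symm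

end GeometryOfNumbers

/-! ### Counting lattice points by averaging over a fundamental domain -/

section LatticePoints

variable {E : Type*} [NormedAddCommGroup E] [MeasurableSpace E] [BorelSpace E]

/-- Averaging the number of lattice translates over a fundamental domain. -/
theorem lintegral_encard_eq_measure (μ : Measure E) [μ.IsAddLeftInvariant] {L : AddSubgroup E}
    [Countable L] {F : Set E} (hF : IsAddFundamentalDomain L F μ) {s : Set E}
    (hs : MeasurableSet s) :
    ∫⁻ x in F, ∑' g : L, s.indicator 1 ((g : E) + x) ∂μ = μ s := by
  rw [← lintegral_indicator_one hs, hF.lintegral_eq_tsum'', lintegral_tsum]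
  · rfl
  · intro g
    exact ((measurable_one.indicator hs).comp (measurable_const_add _)).aemeasurable

/-- A ball of radius `R / 2` is covered at most `N` times by the lattice if the ball of radius `R`
contains `N` lattice points. -/
theorem measure_ball_le_card_mul (μ : Measure E) [μ.IsAddLeftInvariant] {L : AddSubgroup E}
    [Countable L] {F : Set E} (hF : IsAddFundamentalDomain L F μ) {R : ℝ} (S : Finset L)
    (hS : ∀ x : L, ‖(x : E)‖ ≤ R → x ∈ S) :
    μ (Metric.ball 0 (R / 2)) ≤ S.card * μ F := by
  rw [← lintegral_encard_eq_measure μ hF Metric.isOpen_ball.measurableSet]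
  calc _ ≤ ∫⁻ _ in F, (S.card : ENNReal) ∂μ := by
        refine lintegral_mono fun x => ?_
        by_cases hx : ∃ g₀ : L, (g₀ : E) + x ∈ Metric.ball (0 : E) (R / 2)
        · obtain ⟨g₀, hg₀⟩ := hx
          -- Recentred at `g₀`, the translates that land in the ball are indexed by lattice vectors
          -- of norm less than `R`, all of which belong to `S`.
          rw [← (Equiv.addRight g₀).tsum_eq, tsum_eq_sum (s := S)]
          · refine (Finset.sum_le_card_nsmul _ _ 1 fun g _ => ?_).trans (by simp)
            exact Set.indicator_le_self' (by simp) _ |>.trans (by simp)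
          · intro g hg
            refine Set.indicator_of_notMem (fun hmem => hg (hS g ?_)) _
            rw [mem_ball_zero_iff] at hg₀ hmem
            have : (g : E) = ((Equiv.addRight g₀ g : L) : E) + x - ((g₀ : E) + x) := by
              simp
            rw [this]
            exact (norm_sub_le _ _).trans (by linarith)
        · push Not at hx
          simp [tsum_congr fun g : L => Set.indicator_of_notMem (hx g) (1 : E → ENNReal)]
    _ = _ := by simp

/-- If every point is within `ρ` of the lattice, the ball of radius `R + ρ` is covered at least as
often as there are lattice points of norm at most `R`. -/
theorem card_mul_le_measure_closedBall (μ : Measure E) [μ.IsAddLeftInvariant] {L : AddSubgroup E}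
    [Countable L] {F : Set E} (hF : IsAddFundamentalDomain L F μ) {R ρ : ℝ}
    (hρ : ∀ x : E, ∃ g : L, ‖(g : E) + x‖ ≤ ρ) (S : Finset L)
    (hS : ∀ x ∈ S, ‖(x : E)‖ ≤ R) :
    S.card * μ F ≤ μ (Metric.closedBall 0 (R + ρ)) := by
  rw [← lintegral_encard_eq_measure μ hF Metric.isClosed_closedBall.measurableSet]
  calc _ = ∫⁻ _ in F, (S.card : ENNReal) ∂μ := by simp
    _ ≤ _ := by
        refine lintegral_mono fun x => ?_
        obtain ⟨g₀, hg₀⟩ := hρ x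
        rw [← (Equiv.addRight g₀).tsum_eq]
        refine le_trans ?_ (ENNReal.sum_le_tsum S)
        rw [Finset.sum_congr rfl (g := fun _ => (1 : ENNReal))]
        · simp
        · intro g hg
          refine Set.indicator_of_mem ?_ _
          rw [mem_closedBall_zero_iff]
          simp only [Equiv.coe_addRight, AddSubgroup.coe_add, add_assoc]
          exact (norm_add_le _ _).trans (add_le_add (hS g hg) hg₀)

end LatticePoints

end InvariantBound

namespace InvariantBound

open MeasureTheory Module Submodule Set NumberField NumberField.mixedEmbedding
  NumberField.InfinitePlace

/-! ### The lattice of integers and its successive minima -/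

section House

open scoped Classical

variable (K : Type*) [Field K] [NumberField K]

-- The sup norm of the mixed space is the maximum over the archimedean places, so balls there are
-- exactly the sets of bounded house.
variable {K} in
theorem norm_mixedEmbedding_eq_house (x : K) : ‖mixedEmbedding K x‖ = house x := by
  rw [norm_eq_sup'_normAtPlace]
  apply le_antisymm
  · refine Finset.sup'_le _ _ fun w _ => ?_
    rw [normAtPlace_apply, ← norm_embedding_eq]
    exact norm_embedding_le_house x _
  · rw [house, canonicalEmbedding.norm_le_iff]
    intro φ
    rw [← InfinitePlace.apply φ x, ← normAtPlace_apply]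
    exact Finset.le_sup' (fun w => normAtPlace w (mixedEmbedding K x)) (Finset.mem_univ _)

theorem finite_house_le (R : ℝ) : {a : 𝓞 K | house (a : K) ≤ R}.Finite := by
  refine Set.Finite.of_injOn (f := fun a : 𝓞 K => (a : K)) (t := {x : K | IsIntegral ℤ x ∧
    ∀ φ : K →+* ℂ, ‖φ x‖ ≤ R}) ?_ RingOfIntegers.coe_injective.injOn
    (Embeddings.finite_of_norm_le K ℂ R)
  intro a ha
  exact ⟨a.isIntegral_coe, (canonicalEmbedding.norm_le_iff _ _).1 ha⟩

theorem ball_eq_convexBodyLT {R : NNReal} (hR : 0 < R) :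
    Metric.ball (0 : mixedSpace K) R = convexBodyLT K (fun _ => R) := by
  rw [← Prod.mk_zero_zero, ← ball_prod_same, ball_pi _ (by simpa using hR),
    ball_pi _ (by simpa using hR)]
  rfl

theorem volume_ball_mixedSpace {R : ℝ} (hR : 0 < R) :
    volume (Metric.ball (0 : mixedSpace K) R) =
      ENNReal.ofReal (2 ^ nrRealPlaces K * Real.pi ^ nrComplexPlaces K * R ^ finrank ℚ K) := by
  lift R to NNReal using hR.le
  rw [ball_eq_convexBodyLT K (by simpa using hR), convexBodyLT_volume, Finset.prod_pow_eq_pow_sum,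
    sum_mult_eq, ENNReal.ofReal, Real.toNNReal_mul (by positivity),
    Real.toNNReal_mul (by positivity), Real.toNNReal_pow (by positivity),
    Real.toNNReal_pow (by positivity), Real.toNNReal_pow (by positivity)]
  have : Real.pi.toNNReal = NNReal.pi := by
    rw [← NNReal.coe_real_pi, Real.toNNReal_coe]
  simp [this]

theorem volume_closedBall_mixedSpace {R : ℝ} (hR : 0 < R) :
    volume (Metric.closedBall (0 : mixedSpace K) R) =
      ENNReal.ofReal (2 ^ nrRealPlaces K * Real.pi ^ nrComplexPlaces K * R ^ finrank ℚ K) := by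
  rw [← volume_ball_mixedSpace K hR, Measure.addHaar_closedBall_eq_addHaar_ball]

theorem volume_fundamentalDomain_eq_ofReal :
    volume (ZSpan.fundamentalDomain (latticeBasis K)) =
      ENNReal.ofReal (2⁻¹ ^ nrComplexPlaces K * √((|discr K| : ℤ) : ℝ)) := by
  rw [volume_fundamentalDomain_latticeBasis, ENNReal.ofReal_mul (by positivity),
    ENNReal.ofReal_pow (by positivity), ENNReal.ofReal_inv_of_pos (by norm_num)]
  congr 1
  · simp
  · rw [ENNReal.ofReal]
    congr 1
    rw [← NNReal.coe_inj]
    simp [Int.norm_eq_abs]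

/-- The image of `𝓞 K` in the mixed space, as an additive subgroup. -/
abbrev intLattice : AddSubgroup (mixedSpace K) :=
  (span ℤ (Set.range (latticeBasis K))).toAddSubgroup

instance countable_intLattice : Countable (intLattice K) := by
  change Countable (span ℤ (Set.range (latticeBasis K)))
  infer_instance

theorem mem_intLattice {x : mixedSpace K} :
    x ∈ intLattice K ↔ ∃ a : 𝓞 K, mixedEmbedding K a = x := by
  rw [Submodule.mem_toAddSubgroup, mem_span_latticeBasis]
  rfl

/-- The ring of integers is in bijection with its image in the mixed space. -/
def intLatticeEquiv : 𝓞 K ≃ intLattice K :=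
  Equiv.ofBijective (fun a => ⟨mixedEmbedding K a, (mem_intLattice K).2 ⟨a, rfl⟩⟩) <| by
    constructor
    · intro a b hab
      exact RingOfIntegers.coe_injective ((mixedEmbedding K).injective (congrArg Subtype.val hab))
    · rintro ⟨x, hx⟩
      obtain ⟨a, rfl⟩ := (mem_intLattice K).1 hx
      exact ⟨a, rfl⟩

theorem norm_intLatticeEquiv (a : 𝓞 K) : ‖(intLatticeEquiv K a : mixedSpace K)‖ = house (a : K) :=
  norm_mixedEmbedding_eq_house (a : K)

theorem isAddFundamentalDomain_intLattice :
    IsAddFundamentalDomain (intLattice K) (ZSpan.fundamentalDomain (latticeBasis K)) :=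
  ZSpan.isAddFundamentalDomain' (latticeBasis K) volume

theorem nrRealPlaces_add_two_mul_nrComplexPlaces :
    nrRealPlaces K + 2 * nrComplexPlaces K = finrank ℚ K :=
  card_add_two_mul_card_eq_rank K

/-- The ball of radius `R / 2` has volume `(π/2)^(r₂) · 2^(-r₂) · R^[K:ℚ]` and the covolume is
`2^(-r₂) √|Disc K|`; the surplus factor `(π/2)^(r₂)` is at least `1`. -/
theorem pow_finrank_le_card_mul_sqrt_discr {R : ℝ} (hR : 0 < R) :
    R ^ finrank ℚ K ≤ {a : 𝓞 K | house (a : K) ≤ R}.ncard * √((|discr K| : ℤ) : ℝ) := by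
  have hfin := finite_house_le K R
  have h := measure_ball_le_card_mul volume (isAddFundamentalDomain_intLattice K) (R := R)
    (hfin.toFinset.map (intLatticeEquiv K).toEmbedding) (by
      intro x hx
      obtain ⟨a, rfl⟩ := (intLatticeEquiv K).surjective x
      rw [norm_intLatticeEquiv] at hx
      simpa using hx)
  rw [volume_ball_mixedSpace K (by positivity), volume_fundamentalDomain_eq_ofReal,
    Finset.card_map, ← Set.ncard_eq_toFinset_card _ hfin, ← ENNReal.ofReal_natCast,
    ← ENNReal.ofReal_mul (by positivity), ENNReal.ofReal_le_ofReal_iff (by positivity)] at h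
  have hd := nrRealPlaces_add_two_mul_nrComplexPlaces K
  have hpi : (1 : ℝ) ≤ (Real.pi / 2) ^ nrComplexPlaces K :=
    one_le_pow₀ (by linarith [Real.two_le_pi])
  calc R ^ finrank ℚ K ≤ (Real.pi / 2) ^ nrComplexPlaces K * R ^ finrank ℚ K :=
        le_mul_of_one_le_left (by positivity) hpi
    _ = 2 ^ nrComplexPlaces K * (2 ^ nrRealPlaces K * Real.pi ^ nrComplexPlaces K *
          (R / 2) ^ finrank ℚ K) := by
        rw [div_pow, div_pow, ← hd, pow_add 2, pow_mul 2, show (2 : ℝ) ^ 2 = 2 * 2 by norm_num,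
          mul_pow 2 2]
        field_simp
    _ ≤ 2 ^ nrComplexPlaces K * (_ * (2⁻¹ ^ nrComplexPlaces K * √((|discr K| : ℤ) : ℝ))) := by
        gcongr
    _ = _ := by
        rw [inv_pow]
        field_simp

theorem span_mixedEmbedding_eq_top {ι : Type*} (b : ι → K) (hb : span ℚ (Set.range b) = ⊤) :
    span ℝ (Set.range fun i => mixedEmbedding K (b i)) = ⊤ := by
  have h : ∀ x : K, mixedEmbedding K x ∈ span ℝ (Set.range fun i => mixedEmbedding K (b i)) := by
    intro x
    have hx : x ∈ span ℚ (Set.range b) := by rw [hb]; trivial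
    induction hx using Submodule.span_induction with
    | mem x hx => obtain ⟨i, rfl⟩ := hx; exact subset_span ⟨i, rfl⟩
    | zero => simp
    | add x y _ _ hx hy => rw [map_add]; exact add_mem hx hy
    | smul c x _ hx =>
      rw [map_rat_smul, ← Rat.cast_smul_eq_qsmul ℝ]
      exact smul_mem _ _ hx
  rw [eq_top_iff, ← (latticeBasis K).span_eq, span_le]
  rintro _ ⟨i, rfl⟩
  rw [latticeBasis_apply]
  exact h _

variable {K} in
/-- A spanning set of elements of `𝓞 K` contains a basis. -/
theorem exists_fin_span_eq_top {s : Set (𝓞 K)}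
    (hs : span ℚ ((fun a : 𝓞 K => (a : K)) '' s) = ⊤) :
    ∃ b : Fin (finrank ℚ K) → 𝓞 K, (∀ i, b i ∈ s) ∧
      span ℚ (Set.range fun i => (b i : K)) = ⊤ := by
  obtain ⟨g, hg, hspan, -⟩ := exists_fun_fin_finrank_span_eq ℚ ((fun a : 𝓞 K => (a : K)) '' s)
  have hd : finrank ℚ (span ℚ ((fun a : 𝓞 K => (a : K)) '' s)) = finrank ℚ K := by
    rw [hs, finrank_top]
  choose b hb hbg using hg
  refine ⟨fun i => b (Fin.cast hd.symm i), fun i => hb _, ?_⟩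
  refine eq_top_iff.2 (hs.ge.trans (hspan.ge.trans (span_mono ?_)))
  rintro _ ⟨i, rfl⟩
  exact ⟨Fin.cast hd i, by simp [hbg]⟩

/-- Rounding down the coordinates in a short basis leaves fractional parts below `1` on `[K:ℚ]`
vectors of norm at most `B`. -/
theorem exists_house_add_le {B : ℝ} (hB : span ℚ ((fun a : 𝓞 K => (a : K)) ''
    {a : 𝓞 K | house (a : K) ≤ B}) = ⊤) (x : mixedSpace K) :
    ∃ g : intLattice K, ‖(g : mixedSpace K) + x‖ ≤ finrank ℚ K * B := by
  obtain ⟨b, hb, hspan⟩ := exists_fin_span_eq_top hB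
  have hx : x ∈ span ℝ (Set.range fun i => mixedEmbedding K (b i : K)) := by
    rw [span_mixedEmbedding_eq_top K _ hspan]; trivial
  obtain ⟨c, rfl⟩ := (mem_span_range_iff_exists_fun ℝ).1 hx
  refine ⟨intLatticeEquiv K (- ∑ i, ⌊c i⌋ • b i), ?_⟩
  have : (intLatticeEquiv K (- ∑ i, ⌊c i⌋ • b i) : mixedSpace K) +
      ∑ i, c i • mixedEmbedding K (b i : K) = ∑ i, Int.fract (c i) • mixedEmbedding K (b i : K) := by
    change mixedEmbedding K ((- ∑ i, ⌊c i⌋ • b i : 𝓞 K) : K) + _ = _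
    simp only [map_neg, map_sum, map_zsmul, ← Int.self_sub_floor, sub_smul, Finset.sum_sub_distrib,
      Int.cast_smul_eq_zsmul]
    abel
  rw [this]
  calc _ ≤ ∑ i, ‖Int.fract (c i) • mixedEmbedding K (b i : K)‖ := norm_sum_le _ _
    _ ≤ ∑ _i : Fin (finrank ℚ K), B := by
        refine Finset.sum_le_sum fun i _ => ?_
        rw [_root_.norm_smul, Real.norm_of_nonneg (Int.fract_nonneg _), norm_mixedEmbedding_eq_house]
        exact (mul_le_of_le_one_left (house_nonneg _) (Int.fract_lt_one _).le).trans (hb i)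
    _ = _ := by simp

/-- The covering radius is at most `R`, so translates by these points fit in the ball of radius
`2R`. The resulting constant `4^(r₁) (8π)^(r₂)` is at most `(2π)^(r₁ + 2r₂)`; this is the source of
the power of `2π` in the theorem. -/
theorem card_mul_sqrt_discr_le {B R : ℝ} (hB : span ℚ ((fun a : 𝓞 K => (a : K)) ''
    {a : 𝓞 K | house (a : K) ≤ B}) = ⊤) (hR : 0 < R) (hBR : finrank ℚ K * B ≤ R) :
    {a : 𝓞 K | house (a : K) ≤ R}.ncard * √((|discr K| : ℤ) : ℝ) ≤
      (2 * Real.pi) ^ finrank ℚ K * R ^ finrank ℚ K := by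
  have hfin := finite_house_le K R
  have h := card_mul_le_measure_closedBall volume (isAddFundamentalDomain_intLattice K) (R := R)
    (exists_house_add_le K hB) (hfin.toFinset.map (intLatticeEquiv K).toEmbedding) (by
      intro x hx
      obtain ⟨a, rfl⟩ := (intLatticeEquiv K).surjective x
      rw [norm_intLatticeEquiv]
      simpa using hx)
  replace h := h.trans (measure_mono (Metric.closedBall_subset_closedBall
    (show R + finrank ℚ K * B ≤ 2 * R by linarith)))
  rw [volume_closedBall_mixedSpace K (by positivity), volume_fundamentalDomain_eq_ofReal,
    Finset.card_map, ← Set.ncard_eq_toFinset_card _ hfin, ← ENNReal.ofReal_natCast,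
    ← ENNReal.ofReal_mul (by positivity), ENNReal.ofReal_le_ofReal_iff (by positivity)] at h
  have hd := nrRealPlaces_add_two_mul_nrComplexPlaces K
  have hpi := Real.two_le_pi
  calc _ = 2 ^ nrComplexPlaces K * ({a : 𝓞 K | house (a : K) ≤ R}.ncard *
        (2⁻¹ ^ nrComplexPlaces K * √((|discr K| : ℤ) : ℝ))) := by
        rw [inv_pow]
        field_simp
    _ ≤ 2 ^ nrComplexPlaces K * (2 ^ nrRealPlaces K * Real.pi ^ nrComplexPlaces K *
          (2 * R) ^ finrank ℚ K) := by gcongr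
    _ = 4 ^ nrRealPlaces K * (8 * Real.pi) ^ nrComplexPlaces K * R ^ finrank ℚ K := by
        have h4 : ∀ c : ℕ, (4 : ℝ) ^ c = 2 ^ c * 2 ^ c := fun c => by rw [← mul_pow]; norm_num
        have h8 : ∀ c : ℕ, (8 : ℝ) ^ c = 2 ^ c * 2 ^ c * 2 ^ c := fun c => by
          rw [← mul_pow, ← mul_pow]; norm_num
        rw [mul_pow 2 R, ← hd, pow_add 2, two_mul, pow_add 2 (nrComplexPlaces K), mul_pow 8, h4, h8]
        ring
    _ ≤ (2 * Real.pi) ^ nrRealPlaces K * ((2 * Real.pi) ^ 2) ^ nrComplexPlaces K *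
          R ^ finrank ℚ K := by
        gcongr
        · linarith
        · nlinarith
    _ = _ := by rw [← pow_mul, ← pow_add, hd]

theorem span_coe_ringOfIntegers : span ℚ (Set.range fun a : 𝓞 K => (a : K)) = ⊤ := by
  rw [eq_top_iff, ← (integralBasis K).span_eq]
  refine span_mono ?_
  rintro _ ⟨i, rfl⟩
  exact ⟨RingOfIntegers.basis K i, by simp [integralBasis_apply]⟩

/-- One greedy step: only finitely many integers have bounded house, so a shortest one outside `V`
exists. -/
theorem exists_forall_house_le_of_notMem {V : Submodule ℚ K} (hV : V ≠ ⊤) :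
    ∃ y : 𝓞 K, (y : K) ∉ V ∧ ∀ x : 𝓞 K, house (x : K) < house (y : K) → (x : K) ∈ V := by
  obtain ⟨x₀, hx₀⟩ : ∃ x₀ : 𝓞 K, (x₀ : K) ∉ V := by
    by_contra! h
    refine hV (eq_top_iff.2 ?_)
    rw [← span_coe_ringOfIntegers, span_le]
    rintro _ ⟨a, rfl⟩
    exact h a
  obtain ⟨y, hy, hmin⟩ := Set.exists_min_image {a : 𝓞 K | house (a : K) ≤ house (x₀ : K) ∧
    (a : K) ∉ V} (fun a => house (a : K)) ((finite_house_le K _).subset fun a ha => ha.1)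
    ⟨x₀, le_rfl, hx₀⟩
  refine ⟨y, hy.2, fun x hx => ?_⟩
  by_contra hxV
  exact (hmin x ⟨hx.le.trans hy.1, hxV⟩).not_gt hx

theorem finrank_span_image_Iio_le {F M : Type*} [Field F] [AddCommGroup M] [Module F M]
    (b : ℕ → M) (j : ℕ) : finrank F (span F (b '' Set.Iio j)) ≤ j := by
  have : b '' Set.Iio j = ((Finset.range j).image b : Finset M) := by simp
  rw [this]
  exact (finrank_span_finset_le_card _).trans (Finset.card_image_le.trans (by simp))

/-- Elements of `𝓞 K` that realize the successive minima. -/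
theorem exists_minimal_sequence : ∃ b : ℕ → 𝓞 K, ∀ i < finrank ℚ K,
    (b i : K) ∉ span ℚ ((fun j => (b j : K)) '' Set.Iio i) ∧
    ∀ x : 𝓞 K, house (x : K) < house (b i : K) →
      (x : K) ∈ span ℚ ((fun j => (b j : K)) '' Set.Iio i) := by
  suffices h : ∀ m ≤ finrank ℚ K, ∃ b : ℕ → 𝓞 K, ∀ i < m,
      (b i : K) ∉ span ℚ ((fun j => (b j : K)) '' Set.Iio i) ∧
      ∀ x : 𝓞 K, house (x : K) < house (b i : K) →
        (x : K) ∈ span ℚ ((fun j => (b j : K)) '' Set.Iio i) from h _ le_rfl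
  intro m
  induction m with
  | zero => exact fun _ => ⟨fun _ => 0, by simp⟩
  | succ m ih =>
    intro hm
    obtain ⟨b, hb⟩ := ih (by omega)
    have hne : span ℚ ((fun j => (b j : K)) '' Set.Iio m) ≠ ⊤ := by
      intro h
      have := finrank_span_image_Iio_le (F := ℚ) (fun j => (b j : K)) m
      rw [h, finrank_top] at this
      omega
    obtain ⟨y, hy, hmin⟩ := exists_forall_house_le_of_notMem K hne
    have himg : ∀ i ≤ m, (fun j => (Function.update b m y j : K)) '' Set.Iio i =
        (fun j => (b j : K)) '' Set.Iio i := by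
      intro i hi
      refine Set.image_congr fun j hj => ?_
      rw [Function.update_of_ne (by rw [Set.mem_Iio] at hj; omega)]
    refine ⟨Function.update b m y, fun i hi => ?_⟩
    rw [himg i (by omega)]
    rcases Nat.lt_succ_iff_lt_or_eq.1 hi with h | rfl
    · rw [Function.update_of_ne h.ne]
      exact hb i h
    · rw [Function.update_self]
      exact ⟨hy, hmin⟩

theorem le_finrank_span_image_Iio {F M : Type*} [Field F] [AddCommGroup M] [Module F M]
    [FiniteDimensional F M] (b : ℕ → M) (m : ℕ)
    (hb : ∀ i < m, b i ∉ span F (b '' Set.Iio i)) : m ≤ finrank F (span F (b '' Set.Iio m)) := by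
  induction m with
  | zero => simp
  | succ m ih =>
    have h1 := ih fun i hi => hb i (by omega)
    have h2 : span F (b '' Set.Iio m) < span F (b '' Set.Iio (m + 1)) := by
      refine lt_of_le_of_ne (span_mono (Set.image_mono (Set.Iio_subset_Iio (by omega)))) ?_
      intro h
      exact hb m (by omega) (h ▸ subset_span ⟨m, by simp, rfl⟩)
    have := finrank_lt_finrank_of_lt h2
    omega

/-- The largest successive minimum is bounded by the product of all of them: the bilinear form
`φ (x * y)`, for `φ` a functional that vanishes on the first `m - 1` vectors, is nondegenerate. -/
theorem house_pow_le_prod_sq (b : ℕ → 𝓞 K) (hb : ∀ i < finrank ℚ K,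
    (b i : K) ∉ span ℚ ((fun j => (b j : K)) '' Set.Iio i) ∧
    ∀ x : 𝓞 K, house (x : K) < house (b i : K) →
      (x : K) ∈ span ℚ ((fun j => (b j : K)) '' Set.Iio i)) :
    house (b (finrank ℚ K - 1) : K) ^ finrank ℚ K ≤
      (∏ i ∈ Finset.range (finrank ℚ K), house (b i : K)) ^ 2 := by
  have hpos : 0 < finrank ℚ K := finrank_pos
  set m := finrank ℚ K with hm
  set U := span ℚ ((fun j => (b j : K)) '' Set.Iio (m - 1)) with hU
  have hUlt : U < ⊤ := lt_top_iff_ne_top.2 fun h =>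
    (hb (m - 1) (by omega)).1 (by rw [← hU, h]; trivial)
  obtain ⟨φ, hφ0, hφ⟩ := U.exists_le_ker_of_lt_top hUlt
  have htop : span ℚ ((fun j => (b j : K)) '' Set.Iio m) = ⊤ :=
    eq_top_of_finrank_eq (le_antisymm (finrank_span_image_Iio_le _ _ |>.trans hm.le)
      (le_finrank_span_image_Iio _ _ fun i hi => (hb i hi).1))
  let c : Fin m → K := fun i => (b i : K)
  have hctop : ⊤ ≤ span ℚ (Set.range c) := by
    rw [← htop]
    refine span_mono ?_
    rintro _ ⟨j, hj, rfl⟩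
    exact ⟨⟨j, hj⟩, rfl⟩
  have hcli : LinearIndependent ℚ c :=
    linearIndependent_of_top_le_span_of_card_eq_finrank hctop (by simp [hm])
  let M : Matrix (Fin m) (Fin m) ℚ := fun i j => φ (c i * c j)
  have hdet : M.det ≠ 0 := by
    intro h0
    obtain ⟨v, hv0, hv⟩ := Matrix.exists_mulVec_eq_zero_iff.2 h0
    set x := ∑ j, v j • c j with hx
    have hx0 : x ≠ 0 := fun h => hv0 (funext (Fintype.linearIndependent_iff.1 hcli v h))
    have hall : ∀ y : K, φ (y * x) = 0 := by
      intro y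
      have hy : y ∈ span ℚ (Set.range c) := hctop trivial
      induction hy using Submodule.span_induction with
      | mem y hy =>
        obtain ⟨i, rfl⟩ := hy
        have := congrFun hv i
        simp only [Matrix.mulVec, dotProduct, M, Pi.zero_apply] at this
        rw [hx, Finset.mul_sum, map_sum, ← this]
        refine Finset.sum_congr rfl fun j _ => ?_
        rw [mul_smul_comm, map_smul, smul_eq_mul, mul_comm]
      | zero => simp
      | add y z _ _ hy hz => rw [add_mul, map_add, hy, hz, add_zero]
      | smul a y _ hy => rw [smul_mul_assoc, map_smul, hy, smul_zero]
    -- In a field every `z` is a multiple of `x`, so a nonzero `x` in the radical would force `φ =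
    -- 0`.
    refine hφ0 (LinearMap.ext fun z => ?_)
    have := hall (z * x⁻¹)
    rwa [inv_mul_cancel_right₀ hx0] at this
  -- Some term of the Leibniz expansion is nonzero. For its permutation `σ`, no product `c (σ i) * c
  -- i` lies in `ker φ`, hence none lies in `U`, and the choice of the last vector makes each
  -- product at least as long as that vector.
  rw [Matrix.det_apply] at hdet
  obtain ⟨σ, -, hσ⟩ := Finset.exists_ne_zero_of_sum_ne_zero hdet
  have hσ' : ∀ i, M (σ i) i ≠ 0 := by
    intro i h0
    refine hσ ?_
    rw [Finset.prod_eq_zero (f := fun i => M (σ i) i) (Finset.mem_univ i) h0, smul_zero]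
  have hle : ∀ i, house (b (m - 1) : K) ≤ house (c (σ i)) * house (c i) := by
    intro i
    refine le_trans ?_ (house_mul_le _ _)
    by_contra! hlt
    have := (hb (m - 1) (by omega)).2 (b (σ i) * b i) (by simpa [c] using hlt)
    exact hσ' i (hφ (by simpa [c] using this))
  calc house (b (m - 1) : K) ^ m = ∏ _i : Fin m, house (b (m - 1) : K) := by simp
    _ ≤ ∏ i, house (c (σ i)) * house (c i) :=
        Finset.prod_le_prod (fun i _ => house_nonneg _) fun i _ => hle i
    _ = _ := by
        rw [Finset.prod_mul_distrib, Equiv.prod_comp σ (fun i => house (c i)), sq,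
          Finset.prod_range (fun i => house (b i : K))]

/-- Minkowski's second theorem for the real spans of the initial segments of `b`, with the factor
`(π/2)^(r₂) ≥ 1` dropped. -/
theorem prod_house_le_sqrt_discr (b : ℕ → 𝓞 K) (hb : ∀ i < finrank ℚ K,
    (b i : K) ∉ span ℚ ((fun j => (b j : K)) '' Set.Iio i) ∧
    ∀ x : 𝓞 K, house (x : K) < house (b i : K) →
      (x : K) ∈ span ℚ ((fun j => (b j : K)) '' Set.Iio i)) :
    ∏ i ∈ Finset.range (finrank ℚ K), house (b i : K) ≤ √((|discr K| : ℤ) : ℝ) := by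
  have hpos : 0 < finrank ℚ K := finrank_pos
  have hfr : finrank ℝ (mixedSpace K) = finrank ℚ K := mixedEmbedding.finrank K
  set m := finrank ℚ K with hm
  let V : ℕ → Submodule ℝ (mixedSpace K) := fun i =>
    span ℝ ((fun j => mixedEmbedding K (b j : K)) '' Set.Iio i)
  have hQR : ∀ i, ∀ x : K, x ∈ span ℚ ((fun j => (b j : K)) '' Set.Iio i) →
      mixedEmbedding K x ∈ V i := by
    intro i x hx
    induction hx using Submodule.span_induction with
    | mem x hx => obtain ⟨j, hj, rfl⟩ := hx; exact subset_span ⟨j, hj, rfl⟩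
    | zero => simp
    | add x y _ _ hx hy => rw [map_add]; exact add_mem hx hy
    | smul c x _ hx =>
      rw [map_rat_smul, ← Rat.cast_smul_eq_qsmul ℝ]
      exact smul_mem _ _ hx
  have htop : span ℚ ((fun j => (b j : K)) '' Set.Iio m) = ⊤ :=
    eq_top_of_finrank_eq (le_antisymm (finrank_span_image_Iio_le _ _ |>.trans hm.le)
      (le_finrank_span_image_Iio _ _ fun i hi => (hb i hi).1))
  -- Constant from index `m - 1` on, because monotonicity and positivity are required on all of `ℕ`.
  let l : ℕ → ℝ := fun i => house (b (min i (m - 1)) : K)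
  have hl0 : ∀ i, 0 < l i := by
    intro i
    refine zero_lt_one.trans_le (one_le_house_of_isIntegral (b _).isIntegral_coe fun h => ?_)
    exact (hb (min i (m - 1)) (by omega)).1 (by rw [h]; exact zero_mem _)
  have hl : Monotone l := by
    refine monotone_nat_of_le_succ fun i => ?_
    by_contra! hlt
    have h1 := (hb (min i (m - 1)) (by omega)).2 _ hlt
    refine (hb (min (i + 1) (m - 1)) (by omega)).1 (span_mono (Set.image_mono ?_) h1)
    exact Set.Iio_subset_Iio (by omega)
  have hVtop : V (finrank ℝ (mixedSpace K)) = ⊤ := by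
    rw [hfr, eq_top_iff, ← (latticeBasis K).span_eq, span_le]
    rintro _ ⟨i, rfl⟩
    rw [latticeBasis_apply]
    exact hQR m _ (by rw [htop]; trivial)
  have key := prod_mul_measure_ball_le volume (isAddFundamentalDomain_intLattice K)
    (by rw [hfr]; exact hpos) l hl0 hl V
    (fun i j hij => span_mono (Set.image_mono (Set.Iio_subset_Iio hij)))
    (by simp [V]) (fun i => finrank_span_image_Iio_le _ i) hVtop (by
      intro i hi x hx hlt
      rw [hfr] at hi
      obtain ⟨a, rfl⟩ := (mem_intLattice K).1 hx
      rw [norm_mixedEmbedding_eq_house] at hlt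
      refine hQR i _ ((hb i hi).2 a ?_)
      simpa [l, min_eq_left (show i ≤ m - 1 by omega)] using hlt)
  have hprod : ∏ i ∈ Finset.range (finrank ℝ (mixedSpace K)), l i =
      ∏ i ∈ Finset.range m, house (b i : K) := by
    rw [hfr]
    refine Finset.prod_congr rfl fun i hi => ?_
    rw [Finset.mem_range] at hi
    simp [l, min_eq_left (show i ≤ m - 1 by omega)]
  have hP0 : 0 ≤ ∏ i ∈ Finset.range m, house (b i : K) :=
    Finset.prod_nonneg fun i _ => house_nonneg _
  rw [hprod, volume_ball_mixedSpace K (by positivity), volume_fundamentalDomain_eq_ofReal,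
    ← ENNReal.ofReal_mul hP0, ENNReal.ofReal_le_ofReal_iff (by positivity)] at key
  have hd := nrRealPlaces_add_two_mul_nrComplexPlaces K
  have hpi : (1 : ℝ) ≤ (Real.pi / 2) ^ nrComplexPlaces K :=
    one_le_pow₀ (by linarith [Real.two_le_pi])
  set P := ∏ i ∈ Finset.range m, house (b i : K)
  calc P ≤ (Real.pi / 2) ^ nrComplexPlaces K * P := le_mul_of_one_le_left hP0 hpi
    _ = 2 ^ nrComplexPlaces K * (P * (2 ^ nrRealPlaces K * Real.pi ^ nrComplexPlaces K *
          (1 / 2) ^ finrank ℚ K)) := by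
        rw [div_pow, div_pow, ← hd, pow_add 2, two_mul, pow_add 2 (nrComplexPlaces K)]
        field_simp
        simp
    _ ≤ 2 ^ nrComplexPlaces K * (2⁻¹ ^ nrComplexPlaces K * √((|discr K| : ℤ) : ℝ)) := by
        gcongr
    _ = _ := by
        rw [inv_pow]
        field_simp

/-- The largest minimum to the power `[K:ℚ]` is at most the square of the product of all minima, and
that product is at most `√|Disc K|`. -/
theorem lambdaMax_pow_le_discr : lambdaMax K ^ finrank ℚ K ≤ ((|discr K| : ℤ) : ℝ) := by
  obtain ⟨b, hb⟩ := exists_minimal_sequence K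
  have hpos : 0 < finrank ℚ K := finrank_pos
  have hle : lambdaMax K ≤ house (b (finrank ℚ K - 1) : K) := by
    refine csInf_le ⟨0, fun t ht => ht.1⟩ ⟨house_nonneg _, ?_⟩
    refine (le_finrank_span_image_Iio (F := ℚ) (fun j => (b j : K)) _
      fun i hi => (hb i hi).1).trans (finrank_mono (span_mono ?_))
    rintro _ ⟨j, hj, rfl⟩
    refine ⟨b j, ?_, rfl⟩
    rw [Set.mem_Iio] at hj
    by_contra! hlt
    have h1 := (hb (finrank ℚ K - 1) (by omega)).1
    have h2 := (hb j hj).2 _ (not_le.1 hlt)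
    exact h1 (span_mono (Set.image_mono (Set.Iio_subset_Iio (by omega))) h2)
  have h0 : 0 ≤ lambdaMax K := Real.sInf_nonneg fun t ht => ht.1
  have h1 := pow_le_pow_left₀ h0 hle (finrank ℚ K)
  have h2 := pow_le_pow_left₀ (Finset.prod_nonneg fun i _ => house_nonneg _)
    (prod_house_le_sqrt_discr K b hb) 2
  rw [Real.sq_sqrt (by positivity)] at h2
  exact (h1.trans (house_pow_le_prod_sq K b hb)).trans h2

/-- The infimum in the definition of `lambdaMax` is attained. -/
theorem span_house_le_eq_top_of_lambdaMax_le {l : ℝ} (hl : lambdaMax K ≤ l) :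
    span ℚ ((fun a : 𝓞 K => (a : K)) '' {a : 𝓞 K | house (a : K) ≤ l}) = ⊤ := by
  -- Houses of integers form a discrete set, so some interval just above `l` contains none of them.
  obtain ⟨ε, hε, hgap⟩ : ∃ ε > 0, ∀ a : 𝓞 K, house (a : K) < l + ε → house (a : K) ≤ l := by
    by_cases hne : {a : 𝓞 K | house (a : K) ≤ l + 1 ∧ l < house (a : K)}.Nonempty
    · obtain ⟨a, ha, hmin⟩ := Set.exists_min_image {a : 𝓞 K | house (a : K) ≤ l + 1 ∧
        l < house (a : K)} (fun a => house (a : K))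
        ((finite_house_le K (l + 1)).subset fun a ha => ha.1) hne
      refine ⟨house (a : K) - l, sub_pos.2 ha.2, fun x hx => ?_⟩
      by_contra! hlt
      have := hmin x ⟨by linarith [ha.1], hlt⟩
      linarith
    · refine ⟨1, one_pos, fun x hx => ?_⟩
      by_contra! hlt
      exact hne ⟨x, hx.le, hlt⟩
  -- Nonemptiness is needed because the real `sInf` of the empty set is `0`.
  have hS : {t : ℝ | 0 ≤ t ∧ finrank ℚ K ≤ finrank ℚ (span ℚ ((fun a : 𝓞 K => (a : K)) ''
      {a : 𝓞 K | house (a : K) ≤ t}))}.Nonempty := by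
    obtain ⟨b, hb⟩ := exists_minimal_sequence K
    refine ⟨∑ i ∈ Finset.range (finrank ℚ K), house (b i : K),
      Finset.sum_nonneg fun i _ => house_nonneg _, ?_⟩
    refine (le_finrank_span_image_Iio (F := ℚ) (fun j => (b j : K)) _
      fun i hi => (hb i hi).1).trans (finrank_mono (span_mono ?_))
    rintro _ ⟨j, hj, rfl⟩
    exact ⟨b j, Finset.single_le_sum (f := fun i => house (b i : K)) (fun i _ => house_nonneg _)
      (Finset.mem_range.2 hj), rfl⟩
  obtain ⟨t, ht, hlt⟩ := exists_lt_of_csInf_lt hS (show lambdaMax K < l + ε by linarith)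
  have h1 : span ℚ ((fun a : 𝓞 K => (a : K)) '' {a : 𝓞 K | house (a : K) ≤ t}) = ⊤ :=
    eq_top_of_finrank_eq (le_antisymm (finrank_le _) ht.2)
  rw [eq_top_iff, ← h1]
  refine span_mono (Set.image_mono fun a ha => hgap a (lt_of_le_of_lt ha hlt))

end House

end InvariantBound

namespace InvariantBound

/-! ### Bézout's bound at nondegenerate zeros, by dimension counting -/

section NondegenerateZeros

variable {σ F : Type*} [Field F]

/-- Restriction of a polynomial to the line through `s` with direction `v`. -/
def restrictLine (s v : σ → F) : MvPolynomial σ F →ₐ[F] Polynomial F :=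
  MvPolynomial.aeval fun j => Polynomial.C (s j) + Polynomial.C (v j) * Polynomial.X

theorem coeff_zero_restrictLine (s v : σ → F) (p : MvPolynomial σ F) :
    (restrictLine s v p).coeff 0 = MvPolynomial.eval s p := by
  rw [Polynomial.coeff_zero_eq_eval_zero, ← Polynomial.coe_evalRingHom, restrictLine,
    MvPolynomial.aeval_def, MvPolynomial.hom_eval₂]
  simp only [Polynomial.algebraMap_eq, Polynomial.coe_evalRingHom, Polynomial.eval_add,
    Polynomial.eval_C, Polynomial.eval_mul, Polynomial.eval_X, mul_zero, add_zero]
  rw [MvPolynomial.eval, MvPolynomial.coe_eval₂Hom]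
  congr 1
  ext
  simp

/-- Lines stand in for a multivariate Taylor expansion: at a common zero `s`, each `f i` restricts
to the variable times a polynomial with constant term `(J v) i`. -/
theorem coeff_one_restrictLine [Fintype σ] (s v : σ → F) (p : MvPolynomial σ F) :
    (restrictLine s v p).coeff 1 = ∑ j, MvPolynomial.eval s (MvPolynomial.pderiv j p) * v j := by
  classical
  induction p using MvPolynomial.induction_on with
  | C a => simp [restrictLine]
  | add p q hp hq => simp [hp, hq, add_mul, Finset.sum_add_distrib]
  | mul_X p i hp =>
    have h0 := coeff_zero_restrictLine s v p
    have hX : restrictLine s v (MvPolynomial.X i) =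
        Polynomial.C (s i) + Polynomial.C (v i) * Polynomial.X := by simp [restrictLine]
    have : ∀ q : Polynomial F, (q * (Polynomial.C (s i) + Polynomial.C (v i) * Polynomial.X)).coeff
        1 = q.coeff 1 * s i + q.coeff 0 * v i := by
      intro q
      rw [mul_add, Polynomial.coeff_add, Polynomial.coeff_mul_C, ← mul_assoc,
        Polynomial.coeff_mul_X, Polynomial.coeff_mul_C]
    rw [map_mul, hX, this, h0, hp]
    simp only [Derivation.leibniz, smul_eq_mul, MvPolynomial.pderiv_X, map_add, map_mul,
      MvPolynomial.eval_X, add_mul, Finset.sum_add_distrib, Pi.single_apply]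
    rw [add_comm, Finset.sum_mul]
    congr 1
    · simp
    · exact Finset.sum_congr rfl fun j _ => by ring

theorem exists_eval_eq_ite [DecidableEq (σ → F)] (S : Finset (σ → F)) (s : σ → F) :
    ∃ g : MvPolynomial σ F, ∀ t ∈ S, MvPolynomial.eval t g = if t = s then 1 else 0 := by
  have h : ∀ t : σ → F, t ≠ s → ∃ g : MvPolynomial σ F,
      MvPolynomial.eval s g = 1 ∧ MvPolynomial.eval t g = 0 := by
    intro t ht
    obtain ⟨j, hj⟩ := Function.ne_iff.1 ht
    refine ⟨MvPolynomial.C (s j - t j)⁻¹ * (MvPolynomial.X j - MvPolynomial.C (t j)), ?_, ?_⟩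
    · simp [inv_mul_cancel₀ (sub_ne_zero.2 (Ne.symm hj))]
    · simp
  choose! g hg using h
  refine ⟨∏ t ∈ S.erase s, g t, fun t ht => ?_⟩
  rw [map_prod]
  split_ifs with hts
  · subst hts
    exact Finset.prod_eq_one fun u hu => (hg u (Finset.ne_of_mem_erase hu)).1
  · exact Finset.prod_eq_zero (Finset.mem_erase.2 ⟨hts, ht⟩) (hg t hts).2

/-- The products of powers of `f` with interpolating polynomials at nondegenerate common zeros of
`f` are linearly independent. -/
theorem linearIndependent_prod_pow_mul [Fintype σ] [DecidableEq σ] [Infinite F] (f : σ → MvPolynomial σ F)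
    (S : Finset (σ → F)) (hS : ∀ s ∈ S, ∀ i, MvPolynomial.eval s (f i) = 0)
    (hJ : ∀ s ∈ S, (Matrix.of fun i j =>
      MvPolynomial.eval s (MvPolynomial.pderiv j (f i))).det ≠ 0)
    (g : S → MvPolynomial σ F) (hg : ∀ s t : S, MvPolynomial.eval s.1 (g t) ≠ 0 ↔ s = t) :
    LinearIndependent F fun x : (σ → ℕ) × S => (∏ i, f i ^ x.1 i) * g x.2 := by
  classical
  rw [linearIndependent_iff']
  intro A c hc
  by_contra! hne
  -- Among the terms of a relation, take one of least vanishing order `e`, attached to a zero `s`.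
  -- In order `e` at `s` only terms with the same `s` and total exponent `e` contribute, since `g t`
  -- vanishes at `s` for `t ≠ s`.
  obtain ⟨x₀, hx₀, hmin⟩ := Finset.exists_min_image (A.filter fun x => c x ≠ 0)
    (fun x => ∑ i, x.1 i) (by
      obtain ⟨x, hx, hcx⟩ := hne
      exact ⟨x, Finset.mem_filter.2 ⟨hx, hcx⟩⟩)
  rw [Finset.mem_filter] at hx₀
  set e := ∑ i, x₀.1 i with he
  set s := x₀.2 with hs
  set J : Matrix σ σ F := Matrix.of fun i j =>
      MvPolynomial.eval s.1 (MvPolynomial.pderiv j (f i)) with hJdef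
  have hu : ∀ v : σ → F, ∀ i, ∃ u : Polynomial F, restrictLine s.1 v (f i) = Polynomial.X * u ∧
      u.coeff 0 = J.mulVec v i := by
    intro v i
    obtain ⟨u, hu⟩ := Polynomial.X_dvd_iff.2
      ((coeff_zero_restrictLine s.1 v (f i)).trans (hS s s.2 i))
    refine ⟨u, hu, ?_⟩
    have := coeff_one_restrictLine s.1 v (f i)
    rw [hu, Polynomial.coeff_X_mul] at this
    rw [this]
    rfl
  let B := A.filter fun x => c x ≠ 0 ∧ x.2 = s ∧ ∑ i, x.1 i = e
  have hvan : ∀ v : σ → F, ∑ x ∈ B, c x * MvPolynomial.eval s.1 (g s) *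
      ∏ i, J.mulVec v i ^ x.1 i = 0 := by
    intro v
    choose u hu1 hu0 using hu v
    have h1 := congrArg (fun p => (restrictLine s.1 v p).coeff e) hc
    simp only [map_sum, map_smul, map_mul, map_prod, map_pow, hu1, map_zero,
      Polynomial.finsetSum_coeff, Polynomial.coeff_smul, smul_eq_mul, mul_pow,
      Finset.prod_mul_distrib, Finset.prod_pow_eq_pow_sum, mul_assoc, Polynomial.coeff_zero,
      Polynomial.coeff_X_pow_mul'] at h1
    rw [← h1, Finset.sum_filter]
    refine Finset.sum_congr rfl fun x hx => ?_
    by_cases hcx : c x = 0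
    · simp [hcx]
    have hle := hmin x (Finset.mem_filter.2 ⟨hx, hcx⟩)
    by_cases hxe : ∑ i, x.1 i = e
    · rw [if_pos hxe.le, hxe, Nat.sub_self, Polynomial.mul_coeff_zero, coeff_zero_restrictLine,
        Polynomial.coeff_zero_prod]
      by_cases hxs : x.2 = s
      · rw [if_pos ⟨hcx, hxs, rfl⟩, hxs]
        simp only [Polynomial.coeff_zero_eq_eval_zero, Polynomial.eval_pow] at hu0 ⊢
        simp only [hu0]
        ring
      · have : MvPolynomial.eval s.1 (g x.2) = 0 := by
          by_contra h
          exact hxs ((hg s x.2).1 h).symm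
        rw [if_neg (fun h => hxs h.2.1), this]
        ring
    · rw [if_neg (fun h => hxe h.2.2), if_neg (by omega), mul_zero]
  -- The leading form in the coordinates `w = J v`. As `J` is invertible, `w` is arbitrary, so the
  -- form vanishes identically and its coefficients are zero.
  let P : MvPolynomial σ F := ∑ x ∈ B, MvPolynomial.monomial (Finsupp.equivFunOnFinite.symm x.1)
    (c x * MvPolynomial.eval s.1 (g s))
  have hP : P = 0 := by
    refine MvPolynomial.funext fun w => ?_
    obtain ⟨v, rfl⟩ : ∃ v, J.mulVec v = w := by
      refine ⟨J⁻¹.mulVec w, ?_⟩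
      rw [Matrix.mulVec_mulVec, Matrix.mul_nonsing_inv _ (isUnit_iff_ne_zero.2 (hJ s s.2)),
        Matrix.one_mulVec]
    rw [map_zero, ← hvan v, map_sum]
    refine Finset.sum_congr rfl fun x _ => ?_
    rw [MvPolynomial.eval_monomial, Finsupp.prod_fintype _ _ (by simp)]
    rfl
  have hcoeff := congrArg (MvPolynomial.coeff (Finsupp.equivFunOnFinite.symm x₀.1)) hP
  rw [MvPolynomial.coeff_zero, MvPolynomial.coeff_sum, Finset.sum_eq_single x₀] at hcoeff
  · rw [MvPolynomial.coeff_monomial, if_pos rfl] at hcoeff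
    exact mul_ne_zero hx₀.2 ((hg s s).2 rfl) hcoeff
  · intro x hx hxne
    rw [MvPolynomial.coeff_monomial, if_neg]
    intro h
    exact hxne (Prod.ext (Finsupp.equivFunOnFinite.symm.injective h)
      (Finset.mem_filter.1 hx).2.2.1)
  · intro h
    exact absurd (Finset.mem_filter.2 ⟨hx₀.1, hx₀.2, rfl, rfl⟩) h

variable [Fintype σ]

/-- Exponent vectors of weighted degree at most `T`. -/
def weightedSimplex (d : σ → ℕ) (T : ℕ) : Finset (σ → ℕ) := by
  classical
  exact (Fintype.piFinset fun _ => Finset.range (T + 1)).filter fun a => ∑ i, a i * d i ≤ T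

theorem mem_weightedSimplex {d : σ → ℕ} (hd : ∀ i, 0 < d i) {T : ℕ} {a : σ → ℕ} :
    a ∈ weightedSimplex d T ↔ ∑ i, a i * d i ≤ T := by
  classical
  rw [weightedSimplex, Finset.mem_filter, Fintype.mem_piFinset, and_iff_right_iff_imp]
  intro h i
  have h1 := (Finset.single_le_sum (f := fun i => a i * d i) (fun _ _ => Nat.zero_le _)
    (Finset.mem_univ i)).trans h
  have h2 := Nat.le_mul_of_pos_right (a i) (hd i)
  rw [Finset.mem_range]
  omega

theorem card_weightedSimplex_le (d : σ → ℕ) (T : ℕ) :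
    (weightedSimplex d T).card ≤ (T + 1) ^ Fintype.card σ := by
  classical
  rw [weightedSimplex]
  refine (Finset.card_filter_le _ _).trans ?_
  simp

/-- Division with remainder by `d i` in each coordinate: there are `∏ d i` possible remainders, and
the quotients satisfy the weighted bound. -/
theorem card_weightedSimplex_one_le {d : σ → ℕ} (hd : ∀ i, 0 < d i) (T : ℕ) :
    (weightedSimplex (fun _ : σ => 1) T).card ≤ (∏ i, d i) * (weightedSimplex d T).card := by
  classical
  have : ∏ i, d i = (Fintype.piFinset fun i => Finset.range (d i)).card := by simp
  rw [this, ← Finset.card_product]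
  refine Finset.card_le_card_of_injOn (fun b => (fun i => b i % d i, fun i => b i / d i)) ?_ ?_
  · intro b hb
    rw [Finset.mem_coe, mem_weightedSimplex (by simp)] at hb
    rw [Finset.mem_coe, Finset.mem_product, Fintype.mem_piFinset, mem_weightedSimplex hd]
    refine ⟨fun i => Finset.mem_range.2 (Nat.mod_lt _ (hd i)), le_trans ?_ hb⟩
    exact Finset.sum_le_sum fun i _ => by simpa using Nat.div_mul_le_self (b i) (d i)
  · intro b _ b' _ h
    funext i
    rw [Prod.mk.injEq] at h
    rw [← Nat.mod_add_div (b i) (d i), ← Nat.mod_add_div (b' i) (d i), congrFun h.1 i,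
      congrFun h.2 i]

/-- The independent products with weighted exponent at most `T` all have degree at most `T + D`,
where `D` bounds the degrees of the interpolating polynomials. What matters is that `D` does not
depend on `T`. -/
theorem exists_card_mul_card_weightedSimplex_le [DecidableEq σ] [Infinite F]
    (f : σ → MvPolynomial σ F) (d : σ → ℕ) (hd0 : ∀ i, 0 < d i)
    (hd : ∀ i, (f i).totalDegree ≤ d i)
    (S : Finset (σ → F)) (hS : ∀ s ∈ S, ∀ i, MvPolynomial.eval s (f i) = 0)
    (hJ : ∀ s ∈ S, (Matrix.of fun i j =>
      MvPolynomial.eval s (MvPolynomial.pderiv j (f i))).det ≠ 0) :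
    ∃ D : ℕ, ∀ T, S.card * (weightedSimplex d T).card ≤
      (weightedSimplex (fun _ : σ => 1) (T + D)).card := by
  classical
  choose g hg using fun s : S => exists_eval_eq_ite S s.1
  have hli := linearIndependent_prod_pow_mul f S hS hJ g (by
    intro s t
    rw [hg t s.1 s.2]
    by_cases h : s = t
    · simp [h]
    · rw [if_neg (fun h' => h (Subtype.ext h'))]
      simp [h])
  refine ⟨Finset.univ.sup fun s => (g s).totalDegree, fun T => ?_⟩
  set D := Finset.univ.sup fun s => (g s).totalDegree with hD
  let M := Submodule.span F (((weightedSimplex (fun _ : σ => 1) (T + D)).image fun a =>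
    MvPolynomial.monomial (Finsupp.equivFunOnFinite.symm a) (1 : F) :
      Finset (MvPolynomial σ F)) : Set (MvPolynomial σ F))
  have hM : ∀ p : MvPolynomial σ F, p.totalDegree ≤ T + D → p ∈ M := by
    intro p hp
    rw [← MvPolynomial.support_sum_monomial_coeff p]
    refine sum_mem fun m hm => ?_
    rw [← mul_one (p.coeff m), ← smul_eq_mul, ← MvPolynomial.smul_monomial]
    refine Submodule.smul_mem _ _ (Submodule.subset_span ?_)
    rw [Finset.mem_coe, Finset.mem_image]
    refine ⟨m, ?_, by simp⟩
    rw [mem_weightedSimplex (by simp)]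
    have := (MvPolynomial.le_totalDegree hm).trans hp
    rw [Finsupp.sum_fintype _ _ (by simp)] at this
    simpa using this
  let φ : (weightedSimplex d T) × S → (σ → ℕ) × S := fun x => (x.1.1, x.2)
  have hφ : Function.Injective φ := by
    rintro ⟨⟨a, ha⟩, s⟩ ⟨⟨b, hb⟩, t⟩ h
    simp only [φ, Prod.mk.injEq] at h
    simp [h.1, h.2]
  have hli' := hli.comp φ hφ
  have hmem : ∀ x, ((fun x : (σ → ℕ) × S => (∏ i, f i ^ x.1 i) * g x.2) ∘ φ) x ∈ M := by
    intro x
    refine hM _ ((MvPolynomial.totalDegree_mul _ _).trans (add_le_add ?_ ?_))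
    · refine (MvPolynomial.totalDegree_finsetProd _ _).trans
        (le_trans (Finset.sum_le_sum fun i _ => ?_) ((mem_weightedSimplex hd0).1 x.1.2))
      exact (MvPolynomial.totalDegree_pow _ _).trans (Nat.mul_le_mul_left _ (hd i))
    · exact Finset.le_sup (f := fun s => (g s).totalDegree) (Finset.mem_univ x.2)
  have hli'' : LinearIndependent F (fun x => (⟨_, hmem x⟩ : M)) :=
    LinearIndependent.of_comp M.subtype hli'
  have h1 := hli''.fintype_card_le_finrank
  have h2 := h1.trans ((finrank_span_finset_le_card _).trans Finset.card_image_le)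
  rw [Fintype.card_prod, Fintype.card_coe, Fintype.card_coe] at h2
  rwa [mul_comm]

/-- **Bézout's bound** for nondegenerate zeros: a system of as many equations as unknowns has at
most `∏ dᵢ` common zeros at which the Jacobian determinant does not vanish. -/
theorem card_nondegenerate_zeros_le [DecidableEq σ] [Infinite F]
    (f : σ → MvPolynomial σ F) (d : σ → ℕ) (hd0 : ∀ i, 0 < d i)
    (hd : ∀ i, (f i).totalDegree ≤ d i)
    (S : Finset (σ → F)) (hS : ∀ s ∈ S, ∀ i, MvPolynomial.eval s (f i) = 0)
    (hJ : ∀ s ∈ S, (Matrix.of fun i j =>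
      MvPolynomial.eval s (MvPolynomial.pderiv j (f i))).det ≠ 0) :
    S.card ≤ ∏ i, d i := by
  obtain ⟨D, hD⟩ := exists_card_mul_card_weightedSimplex_le f d hd0 hd S hS hJ
  by_contra! hlt
  set p := ∏ i, d i with hp
  have hp0 : 0 < p := Finset.prod_pos fun i _ => hd0 i
  let W : ℕ → ℕ := fun T => (weightedSimplex (fun _ : σ => 1) T).card
  -- With more than `p` zeros, `W` would grow by the factor `1 + 1/p` at each step of length `D`,
  -- hence exponentially, whereas it is bounded by a polynomial.
  have hstep : ∀ T, (p + 1) * W T ≤ p * W (T + D) := by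
    intro T
    calc (p + 1) * W T ≤ S.card * (p * (weightedSimplex d T).card) :=
          Nat.mul_le_mul hlt (card_weightedSimplex_one_le hd0 T)
      _ = p * (S.card * (weightedSimplex d T).card) := by ring
      _ ≤ _ := Nat.mul_le_mul_left _ (hD T)
  have hgrow : ∀ k : ℕ, (p + 1) ^ k ≤ p ^ k * W (k * D) := by
    intro k
    induction k with
    | zero =>
      have : (0 : σ → ℕ) ∈ weightedSimplex (fun _ : σ => 1) 0 :=
        (mem_weightedSimplex (by simp)).2 (by simp)
      simpa [W] using Finset.card_pos.2 ⟨_, this⟩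
    | succ k ih =>
      calc (p + 1) ^ (k + 1) = (p + 1) * (p + 1) ^ k := by ring
        _ ≤ (p + 1) * (p ^ k * W (k * D)) := Nat.mul_le_mul_left _ ih
        _ = p ^ k * ((p + 1) * W (k * D)) := by ring
        _ ≤ p ^ k * (p * W (k * D + D)) := Nat.mul_le_mul_left _ (hstep _)
        _ = _ := by rw [Nat.succ_mul]; ring
  set N := Fintype.card σ
  have hbound : ∀ k : ℕ, 1 ≤ k → (1 + 1 / (p : ℝ)) ^ k ≤ ((D : ℝ) + 1) ^ N * (k : ℝ) ^ N := by
    intro k hk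
    have h1 : (p + 1) ^ k ≤ p ^ k * ((D + 1) * k) ^ N := by
      refine (hgrow k).trans (Nat.mul_le_mul_left _ ((card_weightedSimplex_le _ _).trans ?_))
      exact Nat.pow_le_pow_left (by nlinarith) _
    have h2 : ((p : ℝ) + 1) ^ k ≤ (p : ℝ) ^ k * (((D : ℝ) + 1) * k) ^ N := by exact_mod_cast h1
    have hp' : (0 : ℝ) < p := by exact_mod_cast hp0
    rw [← mul_pow, show 1 + 1 / (p : ℝ) = (p + 1) / p by field_simp, div_pow,
      div_le_iff₀ (by positivity), mul_comm]
    exact h2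
  have hr : 1 < 1 + 1 / (p : ℝ) := by
    have : (0 : ℝ) < p := by exact_mod_cast hp0
    linarith [one_div_pos.2 this]
  have hlim := (tendsto_pow_const_div_const_pow_of_one_lt N hr).const_mul (((D : ℝ) + 1) ^ N)
  rw [mul_zero] at hlim
  have hev := (hlim.eventually (gt_mem_nhds one_pos)).and (Filter.eventually_ge_atTop 1)
  obtain ⟨k, hk, hk1⟩ := hev.exists
  rw [← mul_div_assoc, div_lt_one (by positivity)] at hk
  exact (hbound k hk1).not_gt hk

end NondegenerateZeros

end InvariantBound

namespace InvariantBound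

open MvPolynomial

/-! ### The Jacobian criterion in characteristic zero -/

section JacobianCriterion

/-- In characteristic zero, a derivation over `A` vanishes on the elements algebraic over `A`. -/
theorem derivation_eq_zero_of_isAlgebraic {A B : Type*} [CommRing A] [IsDomain A] [CharZero A]
    [CommRing B] [IsDomain B] [Algebra A B] [FaithfulSMul A B] (D : Derivation A B B) {x : B}
    (hx : IsAlgebraic A x) : D x = 0 := by
  classical
  -- For `p` of least degree, `p'(x) ≠ 0`, while `p'(x) · D x = D (p(x)) = 0`.
  have hex : ∃ m, ∃ p : Polynomial A, p ≠ 0 ∧ Polynomial.aeval x p = 0 ∧ p.natDegree = m := by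
    obtain ⟨p, hp, h⟩ := hx
    exact ⟨_, p, hp, h, rfl⟩
  obtain ⟨p, hp0, hpx, hpm⟩ := Nat.find_spec hex
  have hdeg : p.natDegree ≠ 0 := by
    intro h
    rw [Polynomial.eq_C_of_natDegree_eq_zero h, Polynomial.aeval_C,
      FaithfulSMul.algebraMap_eq_zero_iff] at hpx
    exact hp0 (by rw [Polynomial.eq_C_of_natDegree_eq_zero h, hpx, Polynomial.C_0])
  have hder : Polynomial.aeval x p.derivative ≠ 0 := by
    intro h
    have h1 := Nat.find_min' hex ⟨p.derivative, fun h0 =>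
      hdeg (Polynomial.derivative_eq_zero.1 h0), h, rfl⟩
    have h2 := Polynomial.natDegree_derivative_lt hdeg
    omega
  have := D.map_aeval p x
  rw [hpx, map_zero, smul_eq_mul] at this
  exact (mul_eq_zero.1 this.symm).resolve_left hder

/-- The **Jacobian criterion**: algebraically independent polynomials, as many as there are
variables, have a nonzero Jacobian determinant. -/
theorem det_pderiv_ne_zero {σ : Type*} [Fintype σ] [DecidableEq σ] {f : σ → MvPolynomial σ ℤ}
    (hf : AlgebraicIndependent ℤ f) : (Matrix.of fun i j => pderiv j (f i)).det ≠ 0 := by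
  intro h0
  obtain ⟨v, hv0, hv⟩ := Matrix.exists_mulVec_eq_zero_iff.2 h0
  have htr : IsTranscendenceBasis ℤ f :=
    hf.isTranscendenceBasis_of_lift_trdeg_le_of_finite (by simp)
  let D₀ : Derivation ℤ (MvPolynomial σ ℤ) (MvPolynomial σ ℤ) := mkDerivation ℤ v
  -- The kernel vector `v` of the Jacobian gives the derivation `∑ v j ∂_j`, which kills every `f i`
  -- and is thus linear over `A`. The variables are algebraic over `A` because `f` is a
  -- transcendence basis, so the derivation kills them too and `v = 0`.
  let A := Algebra.adjoin ℤ (Set.range f)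
  have hD₀ : ∀ a ∈ A, D₀ a = 0 := by
    refine Derivation.eqOn_adjoin (D1 := D₀) (D2 := 0) ?_
    rintro _ ⟨i, rfl⟩
    have := congrFun hv i
    simp only [Matrix.mulVec, dotProduct, Matrix.of_apply, Pi.zero_apply] at this
    rw [Derivation.zero_apply, ← this]
    have happ : ∀ p, (∑ j, v j • pderiv j : Derivation ℤ (MvPolynomial σ ℤ) (MvPolynomial σ ℤ)) p =
        ∑ j, v j * pderiv j p := fun p => by
      have := congrFun (map_sum Derivation.coeFnAddMonoidHom (fun j => v j • pderiv j)
        Finset.univ) p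
      rw [Finset.sum_apply] at this
      exact this
    have hsum : D₀ = ∑ j, v j • pderiv j := by
      refine MvPolynomial.derivation_ext fun j => ?_
      simp [D₀, mkDerivation_X, happ, pderiv_X, Pi.single_apply]
    rw [hsum, happ]
    exact Finset.sum_congr rfl fun j _ => mul_comm _ _
  let D : Derivation A (MvPolynomial σ ℤ) (MvPolynomial σ ℤ) :=
    { toFun := D₀
      map_add' := map_add D₀
      map_smul' := by
        intro a x
        rw [RingHom.id_apply, Subalgebra.smul_def, smul_eq_mul, D₀.leibniz, hD₀ _ a.2]
        simp [Subalgebra.smul_def]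
      map_one_eq_zero' := D₀.map_one_eq_zero
      leibniz' := D₀.leibniz }
  have halg := htr.isAlgebraic
  refine hv0 (funext fun j => ?_)
  have hXj := derivation_eq_zero_of_isAlgebraic D (halg.isAlgebraic (X j))
  have : D₀ (X j) = 0 := hXj
  simpa [D₀, mkDerivation_X] using this

theorem totalDegree_pos_of_algebraicIndependent {σ ι : Type*} {f : ι → MvPolynomial σ ℤ}
    (hf : AlgebraicIndependent ℤ f) (i : ι) : 0 < (f i).totalDegree := by
  rw [Nat.pos_iff_ne_zero]
  intro h
  refine hf.transcendental i ?_
  rw [totalDegree_eq_zero_iff_eq_C.1 h]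
  exact isAlgebraic_algebraMap _

theorem totalDegree_pderiv_le {σ R : Type*} [CommSemiring R] (j : σ) (p : MvPolynomial σ R) :
    (pderiv j p).totalDegree ≤ p.totalDegree - 1 := by
  classical
  conv_lhs => rw [← support_sum_monomial_coeff p, map_sum]
  refine totalDegree_finsetSum_le fun m hm => ?_
  rw [pderiv_monomial]
  by_cases hmj : m j = 0
  · simp [hmj]
  refine (totalDegree_monomial_le _ _).trans ?_
  have h1 := le_totalDegree hm
  have h2 : m.degree = (m - Finsupp.single j 1).degree + 1 := by
    conv_lhs => rw [← Finsupp.sub_add_single_one_cancel hmj]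
    simp
  have h3 : m.sum (fun _ e => e) = m.degree := rfl
  change (m - Finsupp.single j 1).degree ≤ _
  omega

/-- Each derivative lowers the degree by one. The gain of one per row later makes the degree of the
bad locus strictly less than `Q`. -/
theorem totalDegree_det_pderiv_add_card_le {σ : Type*} [Fintype σ] [DecidableEq σ]
    {f : σ → MvPolynomial σ ℤ} (hf : ∀ i, 0 < (f i).totalDegree) :
    (Matrix.of fun i j => pderiv j (f i)).det.totalDegree + Fintype.card σ ≤
      ∑ i, (f i).totalDegree := by
  have h1 : (Matrix.of fun i j => pderiv j (f i)).det.totalDegree ≤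
      ∑ i, ((f i).totalDegree - 1) := by
    rw [← Matrix.det_transpose, Matrix.det_apply]
    refine totalDegree_finsetSum_le fun s _ => ?_
    rw [Units.smul_def]
    refine (totalDegree_smul_le _ _).trans ((totalDegree_finsetProd _ _).trans ?_)
    exact Finset.sum_le_sum fun i _ => totalDegree_pderiv_le _ _
  have h2 : ∑ i, (f i).totalDegree = ∑ i, ((f i).totalDegree - 1) + Fintype.card σ := by
    rw [← Finset.card_univ, Finset.card_eq_sum_ones, ← Finset.sum_add_distrib]
    exact Finset.sum_congr rfl fun i _ => by have := hf i; omega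
  omega

end JacobianCriterion

end InvariantBound

namespace InvariantBound

open Module NumberField

/-! ### Sizes and degrees under substitution; traces of short bases -/

section Polynomials

open MvPolynomial

theorem eval_one_absPoly {τ : Type*} (f : MvPolynomial τ ℤ) :
    eval (fun _ => (1 : ℤ)) (absPoly f) = ∑ m ∈ f.support, |f.coeff m| := by
  simp [absPoly, eval_monomial]

theorem one_le_eval_one_absPoly {τ : Type*} {f : MvPolynomial τ ℤ} (hf : f ≠ 0) :
    1 ≤ eval (fun _ => (1 : ℤ)) (absPoly f) := by
  rw [eval_one_absPoly]
  obtain ⟨m, hm⟩ := support_nonempty.2 hf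
  exact (Int.one_le_abs (mem_support_iff.1 hm)).trans
    (Finset.single_le_sum (f := fun m => |f.coeff m|) (fun _ _ => abs_nonneg _) hm)

theorem norm_aeval_le {τ : Type*} (f : MvPolynomial τ ℤ) {H : ℝ} (hH : 1 ≤ H) (z : τ → ℂ)
    (hz : ∀ i, ‖z i‖ ≤ H) :
    ‖aeval z f‖ ≤ (eval (fun _ => (1 : ℤ)) (absPoly f) : ℝ) * H ^ f.totalDegree := by
  rw [eval_one_absPoly, aeval_def, eval₂_eq, Int.cast_sum, Finset.sum_mul]
  refine (norm_sum_le _ _).trans (Finset.sum_le_sum fun m hm => ?_)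
  rw [norm_mul, algebraMap_int_eq, eq_intCast, Complex.norm_intCast, norm_prod, Int.cast_abs]
  gcongr
  calc ∏ i ∈ m.support, ‖z i ^ m i‖ ≤ ∏ i ∈ m.support, H ^ m i := by
        refine Finset.prod_le_prod (fun i _ => norm_nonneg _) fun i _ => ?_
        rw [norm_pow]
        exact pow_le_pow_left₀ (norm_nonneg _) (hz i) _
    _ = H ^ (∑ i ∈ m.support, m i) := Finset.prod_pow_eq_pow_sum _ _ _
    _ ≤ _ := pow_le_pow_right₀ hH (le_totalDegree hm)

theorem totalDegree_aeval_le {σ τ F : Type*} [Field F] (g : σ → MvPolynomial τ F)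
    (hg : ∀ i, (g i).totalDegree ≤ 1) (p : MvPolynomial σ F) :
    (aeval g p).totalDegree ≤ p.totalDegree := by
  rw [aeval_def, eval₂_eq]
  refine totalDegree_finsetSum_le fun m hm => ?_
  refine (totalDegree_mul _ _).trans ?_
  rw [algebraMap_eq, totalDegree_C, zero_add]
  refine (totalDegree_finsetProd _ _).trans (le_trans (Finset.sum_le_sum fun i _ => ?_)
    (le_totalDegree hm))
  exact (totalDegree_pow _ _).trans ((Nat.mul_le_mul_left _ (hg i)).trans (by simp))

end Polynomials

section Trace

/-- The trace is surjective and is a sum of `[K:k]` conjugates, so a short spanning set of `𝓞 K`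
maps to one of `𝓞 k`. Thus `λ_max(K)` also controls the lattice `𝓞 k`. -/
theorem span_house_le_mul_finrank_eq_top {k K : Type*} [Field k] [NumberField k] [Field K]
    [NumberField K] [Algebra k K] {l : ℝ} (h : Submodule.span ℚ ((fun a : 𝓞 K => (a : K)) ''
      {a : 𝓞 K | house (a : K) ≤ l}) = ⊤) :
    Submodule.span ℚ ((fun a : 𝓞 k => (a : k)) ''
      {a : 𝓞 k | house (a : k) ≤ finrank k K * l}) = ⊤ := by
  have : FiniteDimensional k K := Module.Finite.of_restrictScalars_finite ℚ k K
  let T : K →ₗ[ℚ] k := (Algebra.trace k K).restrictScalars ℚ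
  have hT : LinearMap.range T = ⊤ := LinearMap.range_eq_top.2 (Algebra.trace_surjective k K)
  rw [eq_top_iff, ← hT, LinearMap.range_eq_map, ← h, Submodule.map_span]
  refine Submodule.span_mono ?_
  rintro _ ⟨_, ⟨a, ha, rfl⟩, rfl⟩
  refine ⟨⟨Algebra.trace k K a, Algebra.isIntegral_trace a.isIntegral_coe⟩, ?_, rfl⟩
  change house (Algebra.trace k K (a : K)) ≤ _
  rw [house, canonicalEmbedding.norm_le_iff]
  intro ψ
  let _ : Algebra k ℂ := ψ.toAlgebra
  have h1 : ψ (Algebra.trace k K (a : K)) = ∑ σ : K →ₐ[k] ℂ, σ (a : K) :=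
    trace_eq_sum_embeddings ℂ
  rw [h1]
  refine (norm_sum_le _ _).trans ?_
  calc ∑ σ : K →ₐ[k] ℂ, ‖σ (a : K)‖ ≤ ∑ _σ : K →ₐ[k] ℂ, l :=
        Finset.sum_le_sum fun σ _ => (norm_embedding_le_house (a : K) (σ : K →+* ℂ)).trans ha
    _ = _ := by simp [AlgHom.card]

end Trace

/-! ### Points of conjugates and values of invariants -/

section Embeddings

variable {k Ω : Type*} [Field k] [NumberField k] [Field Ω] [Algebra k Ω]
  {n r : ℕ} {K : IntermediateField k Ω}

/-- The point of `(𝔸ⁿ)ʳ` whose coordinates are the conjugates of `α₁, …, αᵣ`. -/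
def conjPoint (τ : Fin n → (K →ₐ[k] Ω)) (α : Fin r → K) : Fin r × Fin n → Ω :=
  fun x => τ x.2 (α x.1)

/-- A functional that kills all the conjugate vectors is a linear relation between distinct
embeddings, which Dedekind's theorem excludes. -/
theorem span_conjugates_eq_top [CharZero K] {m : ℕ} {τ : Fin n → (K →ₐ[k] Ω)}
    (hτ : Function.Injective τ) (b : Fin m → K) (hb : Submodule.span ℚ (Set.range b) = ⊤) :
    Submodule.span Ω (Set.range fun l => fun i => τ i (b l)) = ⊤ := by
  by_contra hne
  obtain ⟨φ, hφ0, hφ⟩ := Submodule.exists_le_ker_of_lt_top _ (lt_top_iff_ne_top.2 hne)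
  refine hφ0 ?_
  have hli := (linearIndependent_toLinearMap k K Ω).comp τ hτ
  rw [Fintype.linearIndependent_iff] at hli
  have hφ' : ∀ w, φ w = ∑ i, φ (Pi.single i 1) * w i := by
    intro w
    conv_lhs => rw [← Finset.univ_sum_single w, map_sum]
    refine Finset.sum_congr rfl fun i _ => ?_
    rw [mul_comm, ← smul_eq_mul, ← map_smul, ← Pi.single_smul, smul_eq_mul, mul_one]
  have h0 : ∀ x : K, ∑ i, φ (Pi.single i 1) * τ i x = 0 := by
    intro x
    have hx : x ∈ Submodule.span ℚ (Set.range b) := by rw [hb]; trivial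
    induction hx using Submodule.span_induction with
    | mem x hx =>
      obtain ⟨l, rfl⟩ := hx
      have := hφ (Submodule.subset_span ⟨l, rfl⟩)
      rw [LinearMap.mem_ker, hφ'] at this
      exact this
    | zero => simp
    | add x y _ _ hx hy => simp only [map_add, mul_add, Finset.sum_add_distrib, hx, hy, add_zero]
    | smul c x _ hx =>
      have : CharZero Ω := charZero_of_injective_algebraMap (algebraMap k Ω).injective
      have h1 : ∀ i, τ i (c • x) = (c : Ω) * τ i x := by
        intro i
        rw [Rat.smul_def, map_mul, map_ratCast]
      simp only [h1, mul_left_comm _ (c : Ω), ← Finset.mul_sum, hx, mul_zero]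
  have h1 := hli (fun i => φ (Pi.single i 1)) (by
    ext x
    simpa using h0 x)
  ext i
  simpa using h1 i

/-- Every coset of a box of small integral combinations of `b` contains a point at which a given
nonzero polynomial does not vanish. -/
theorem exists_eval_conjPoint_ne_zero [CharZero K] {m : ℕ} {τ : Fin n → (K →ₐ[k] Ω)}
    (hτ : Function.Injective τ) (b : Fin m → K) (hb : Submodule.span ℚ (Set.range b) = ⊤)
    {P : MvPolynomial (Fin r × Fin n) Ω} (hP : P ≠ 0) (a : Fin r → K) (I : Finset ℤ)
    (hI : P.totalDegree < I.card) :
    ∃ t : Fin r × Fin m → I,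
      MvPolynomial.eval (conjPoint τ fun j => a j + ∑ l, (t (j, l) : ℤ) • b l) P ≠ 0 := by
  have : CharZero Ω := charZero_of_injective_algebraMap (algebraMap k Ω).injective
  let g : Fin r × Fin n → MvPolynomial (Fin r × Fin m) Ω := fun x =>
    MvPolynomial.C (τ x.2 (a x.1)) +
      ∑ l, MvPolynomial.C (τ x.2 (b l)) * MvPolynomial.X (x.1, l)
  let Q := MvPolynomial.aeval g P
  have hQeval : ∀ w, MvPolynomial.eval w Q = MvPolynomial.eval
      (fun x => τ x.2 (a x.1) + ∑ l, τ x.2 (b l) * w (x.1, l)) P := by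
    intro w
    have := MvPolynomial.comp_aeval_apply (f := g) (MvPolynomial.aeval (R := Ω) w) P
    rw [MvPolynomial.aeval_eq_eval] at this
    change MvPolynomial.eval w Q = _ at this
    rw [this, ← MvPolynomial.aeval_eq_eval]
    simp only [g, map_add, map_sum, map_mul, MvPolynomial.aeval_C, MvPolynomial.aeval_X]
    rfl
  -- The substitution is an affine map onto `(𝔸ⁿ)ʳ`, since the conjugate vectors of the `b l` span;
  -- a nonzero polynomial stays nonzero.
  have hQ0 : Q ≠ 0 := by
    obtain ⟨w, hw⟩ : ∃ w, MvPolynomial.eval w P ≠ 0 := by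
      by_contra! h
      exact hP (MvPolynomial.funext fun w => by rw [h, map_zero])
    have hsurj : ∀ j, ∃ c : Fin m → Ω, ∑ l, c l • (fun i => τ i (b l)) =
        fun i => w (j, i) - τ i (a j) := by
      intro j
      have h1 : (fun i => w (j, i) - τ i (a j)) ∈
          Submodule.span Ω (Set.range fun l => fun i => τ i (b l)) := by
        rw [span_conjugates_eq_top hτ b hb]; trivial
      exact (Submodule.mem_span_range_iff_exists_fun Ω).1 h1
    choose c hc using hsurj
    intro h0
    have h2 := hQeval fun x => c x.1 x.2
    rw [h0, map_zero] at h2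
    refine hw (Eq.trans ?_ h2.symm)
    congr 2
    funext x
    have h3 := congrFun (hc x.1) x.2
    simp only [Finset.sum_apply, Pi.smul_apply, smul_eq_mul] at h3
    simp only [mul_comm (τ x.2 _), h3]
    simp
  have hQdeg : Q.totalDegree ≤ P.totalDegree := by
    refine totalDegree_aeval_le g (fun x => ?_) P
    refine (MvPolynomial.totalDegree_add _ _).trans (max_le (by simp) ?_)
    refine MvPolynomial.totalDegree_finsetSum_le fun l _ => ?_
    refine (MvPolynomial.totalDegree_mul _ _).trans ?_
    rw [MvPolynomial.totalDegree_C, MvPolynomial.totalDegree_X]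
  have hcast : Function.Injective (Int.cast : ℤ → Ω) := Int.cast_injective
  obtain ⟨w, hwI, hw⟩ : ∃ w : Fin r × Fin m → Ω,
      (∀ x, w x ∈ I.map ⟨_, hcast⟩) ∧ MvPolynomial.eval w Q ≠ 0 := by
    by_contra! h
    -- A polynomial whose degree in each variable is less than `I.card` cannot vanish on the whole
    -- grid unless it is zero.
    refine hQ0 (MvPolynomial.eq_zero_of_eval_zero_at_prod_finset Q (fun _ => I.map ⟨_, hcast⟩)
      (fun x => ?_) h)
    rw [Finset.card_map]
    exact ((MvPolynomial.degreeOf_le_totalDegree _ _).trans hQdeg).trans_lt hI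
  choose t ht htw using fun x => Finset.mem_map.1 (hwI x)
  refine ⟨fun x => ⟨t x, ht x⟩, ?_⟩
  rw [hQeval] at hw
  have hpt : (conjPoint τ fun j => a j + ∑ l, t (j, l) • b l) =
      fun x => τ x.2 (a x.1) + ∑ l, τ x.2 (b l) * w (x.1, l) := by
    funext x
    simp only [conjPoint, map_add, map_sum, zsmul_eq_mul, map_mul, map_intCast]
    congr 1
    refine Finset.sum_congr rfl fun l _ => ?_
    rw [← htw, mul_comm]
    rfl
  change MvPolynomial.eval (conjPoint τ fun j => a j + ∑ l, t (j, l) • b l) P ≠ 0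
  rwa [hpt]

variable [IsAlgClosure k Ω]

/-- The embeddings of `K` can be numbered so that a given index belongs to the inclusion and the
values of the invariants at points of conjugates lie in `k`. -/
theorem exists_embeddings [FiniteDimensional k K] {G : Subgroup (Equiv.Perm (Fin n))}
    (hG : MulAction.IsPretransitive G (Fin n)) (hK : HasGaloisGroup G K) (i₀ : Fin n) :
    ∃ τ : Fin n → (K →ₐ[k] Ω), τ i₀ = K.val ∧ Function.Injective τ ∧
      ∀ f : MvPolynomial (Fin r × Fin n) ℤ, IsInvariant G f → ∀ α : Fin r → K,
        ∃ c : k, algebraMap k Ω c = MvPolynomial.aeval (conjPoint τ α) f := by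
  obtain ⟨e, φ, hφ⟩ := hK
  have : Algebra.IsAlgebraic k Ω := IsAlgClosure.isAlgebraic
  have : IsAlgClosed Ω := IsAlgClosure.isAlgClosed k
  have : Normal k Ω := IsAlgClosure.normal k Ω
  let N := IntermediateField.normalClosure k K Ω
  let ι : K →ₐ[k] N := IntermediateField.inclusion K.le_normalClosure
  -- Transitivity moves the index of the inclusion to `i₀`; all embeddings are then twisted by the
  -- inverse automorphism. The twist does not change the values of the invariants, since these are
  -- fixed by the Galois group.
  obtain ⟨g, hg⟩ := hG.exists_smul_eq (e ι) i₀
  let σ₀ : N ≃ₐ[k] N := φ.symm g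
  have hσ₀ : e (σ₀.toAlgHom.comp ι) = i₀ := by
    rw [hφ, MulEquiv.apply_symm_apply]
    exact hg
  refine ⟨fun i => N.val.comp (σ₀.symm.toAlgHom.comp (e.symm i)), ?_, ?_, ?_⟩
  · have h1 : e.symm i₀ = σ₀.toAlgHom.comp ι := by rw [← hσ₀, Equiv.symm_apply_apply]
    ext x
    change ((σ₀.symm (e.symm i₀ x) : N) : Ω) = x
    rw [h1]
    change ((σ₀.symm (σ₀ (ι x)) : N) : Ω) = x
    rw [AlgEquiv.symm_apply_apply]
    rfl
  · intro i j hij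
    refine e.symm.injective (AlgHom.ext fun x => ?_)
    have := DFunLike.congr_fun hij x
    exact σ₀.symm.injective (N.val.injective this)
  · intro f hf α
    let y : Fin r × Fin n → N := fun x => e.symm x.2 (α x.1)
    have hfix : ∀ σ : N ≃ₐ[k] N, σ (MvPolynomial.aeval y f) = MvPolynomial.aeval y f := by
      intro σ
      have h1 : σ (MvPolynomial.aeval y f) = MvPolynomial.aeval (fun x => σ (y x)) f := by
        have := MvPolynomial.comp_aeval_apply (f := y) ((σ.toAlgHom.restrictScalars ℤ)) f
        exact this
      have h2 : (fun x => σ (y x)) = fun x : Fin r × Fin n =>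
          y (x.1, (φ σ : Equiv.Perm (Fin n)) x.2) := by
        funext x
        have h3 := hφ σ (e.symm x.2)
        rw [Equiv.apply_symm_apply] at h3
        simp only [y]
        rw [← h3, Equiv.symm_apply_apply]
        rfl
      have h4 := congrArg (MvPolynomial.aeval y) (hf (φ σ) (φ σ).2)
      rw [permute, MvPolynomial.aeval_rename] at h4
      rw [h1, h2]
      exact h4
    obtain ⟨c, hc⟩ := (IsGalois.mem_range_algebraMap_iff_fixed (F := k)
      (MvPolynomial.aeval y f)).2 hfix
    refine ⟨c, ?_⟩
    have h5 : MvPolynomial.aeval (conjPoint (fun i => N.val.comp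
        (σ₀.symm.toAlgHom.comp (e.symm i))) α) f = N.val (σ₀.symm (MvPolynomial.aeval y f)) := by
      have := MvPolynomial.comp_aeval_apply (f := y)
        (((N.val.comp σ₀.symm.toAlgHom).restrictScalars ℤ)) f
      exact this.symm
    rw [h5, hfix σ₀.symm, ← hc]
    rfl

/-- Every complex embedding of `k` extends to `Ω`, and it then sends the coordinates of the point to
complex conjugates of the `α j`, which are bounded by their houses. -/
theorem isIntegral_and_house_le [NumberField K] (τ : Fin n → (K →ₐ[k] Ω)) (α : Fin r → 𝓞 K)
    {H : ℝ} (hH : 1 ≤ H) (hα : ∀ j, house (α j : K) ≤ H) (f : MvPolynomial (Fin r × Fin n) ℤ)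
    {c : k} (hc : algebraMap k Ω c = MvPolynomial.aeval (conjPoint τ fun j => (α j : K)) f) :
    IsIntegral ℤ c ∧ house c ≤
      (MvPolynomial.eval (fun _ => (1 : ℤ)) (absPoly f) : ℝ) * H ^ f.totalDegree := by
  have : Algebra.IsAlgebraic k Ω := IsAlgClosure.isAlgebraic
  constructor
  · refine (isIntegral_algHom_iff ((Algebra.ofId k Ω).restrictScalars ℤ)
      (algebraMap k Ω).injective).1 ?_
    change IsIntegral ℤ (algebraMap k Ω c)
    rw [hc, MvPolynomial.aeval_def, MvPolynomial.eval₂_eq]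
    refine IsIntegral.sum _ fun m _ => IsIntegral.mul isIntegral_algebraMap
      (IsIntegral.prod _ fun x _ => IsIntegral.pow ?_ _)
    exact (α x.1).isIntegral_coe.map ((τ x.2).restrictScalars ℤ)
  · rw [house, canonicalEmbedding.norm_le_iff]
    intro ψ
    let _ : Algebra k ℂ := ψ.toAlgebra
    let Ψ : Ω →ₐ[k] ℂ := IsAlgClosed.lift
    have h1 : ψ c = MvPolynomial.aeval (fun x => Ψ (conjPoint τ (fun j => (α j : K)) x)) f := by
      have h2 : ψ c = Ψ (algebraMap k Ω c) := (Ψ.commutes c).symm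
      rw [h2, hc]
      exact MvPolynomial.comp_aeval_apply (f := conjPoint τ fun j => (α j : K))
        (Ψ.restrictScalars ℤ) f
    rw [h1]
    refine norm_aeval_le f hH _ fun x => ?_
    exact (norm_embedding_le_house (α x.1 : K) ((Ψ.comp (τ x.2) : K →ₐ[k] ℂ) : K →+* ℂ)).trans
      (hα x.1)

/-- The `τ i` are all the embeddings, by counting, and an element whose conjugates are distinct is
primitive. -/
theorem adjoin_eq_of_injective [FiniteDimensional k K] (hn : finrank k K = n)
    {τ : Fin n → (K →ₐ[k] Ω)} (hτ : Function.Injective τ) {a : K}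
    (ha : Function.Injective fun i => τ i a) : IntermediateField.adjoin k {(a : Ω)} = K := by
  have : IsAlgClosed Ω := IsAlgClosure.isAlgClosed k
  have hbij : Function.Bijective τ :=
    (Fintype.bijective_iff_injective_and_card τ).2 ⟨hτ, by simp [AlgHom.card, hn]⟩
  have htop : IntermediateField.adjoin k {a} = ⊤ := by
    rw [Field.primitive_element_iff_algHom_eq_of_eval' k Ω (fun _ => IsAlgClosed.splits _)]
    intro φ ψ h
    obtain ⟨i, rfl⟩ := hbij.2 φ
    obtain ⟨j, rfl⟩ := hbij.2 ψ
    rw [ha h]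
  have := congrArg (IntermediateField.map K.val) htop
  rwa [IntermediateField.adjoin_map, Set.image_singleton, ← AlgHom.fieldRange_eq_map,
    IntermediateField.fieldRange_val] at this

end Embeddings

end InvariantBound

namespace InvariantBound

open Module NumberField

/-! ### The locus to be avoided -/

section BadLocus

open MvPolynomial

variable {n r : ℕ}

/-- The Jacobian determinant times the discriminant factor of the `j₀`-th copy of `𝔸ⁿ`. -/
def badLocus (f : Fin r × Fin n → MvPolynomial (Fin r × Fin n) ℤ) (j₀ : Fin r) :
    MvPolynomial (Fin r × Fin n) ℤ :=
  (Matrix.of fun i j => pderiv j (f i)).det *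
    ∏ i : Fin n, ∏ i' ∈ Finset.Ioi i, (X (j₀, i') - X (j₀, i))

theorem badLocus_ne_zero {f : Fin r × Fin n → MvPolynomial (Fin r × Fin n) ℤ}
    (hf : AlgebraicIndependent ℤ f) (j₀ : Fin r) : badLocus f j₀ ≠ 0 := by
  refine mul_ne_zero (det_pderiv_ne_zero hf) (Finset.prod_ne_zero_iff.2 fun i _ =>
    Finset.prod_ne_zero_iff.2 fun i' hi' => sub_ne_zero.2 fun h => ?_)
  have := congrArg Prod.snd (X_injective h)
  exact (Finset.mem_Ioi.1 hi').ne' this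

/-- The Jacobian contributes `deg 𝓘 - nr` and the Vandermonde factor `n.choose 2`; this is the
origin of `deg 𝓘 + n.choose 2` in the constant. -/
theorem totalDegree_badLocus_add_le {f : Fin r × Fin n → MvPolynomial (Fin r × Fin n) ℤ}
    (hf : ∀ i, 0 < (f i).totalDegree) (j₀ : Fin r) :
    (badLocus f j₀).totalDegree + n * r ≤ ∑ i, (f i).totalDegree + n.choose 2 := by
  have h1 := totalDegree_det_pderiv_add_card_le hf
  have h2 : (∏ i : Fin n, ∏ i' ∈ Finset.Ioi i, (X (j₀, i') - X (j₀, i)) :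
      MvPolynomial (Fin r × Fin n) ℤ).totalDegree ≤ n.choose 2 := by
    calc _ ≤ ∑ i : Fin n, ∑ i' ∈ Finset.Ioi i, 1 := by
          refine (totalDegree_finsetProd _ _).trans (Finset.sum_le_sum fun i _ => ?_)
          refine (totalDegree_finsetProd _ _).trans (Finset.sum_le_sum fun i' _ => ?_)
          refine (totalDegree_sub _ _).trans ?_
          simp
      _ = ∑ i : Fin n, (n - 1 - i) := by simp
      _ = n.choose 2 := by
          rw [Fin.sum_univ_eq_sum_range (fun i => n - 1 - i) n, Finset.sum_range_reflect
            (fun i => i) n, Finset.sum_range_id, Nat.choose_two_right]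
  have h3 := totalDegree_mul (Matrix.of fun i j => pderiv j (f i)).det
    (∏ i : Fin n, ∏ i' ∈ Finset.Ioi i, (X (j₀, i') - X (j₀, i)))
  have h4 : Fintype.card (Fin r × Fin n) = n * r := by simp [mul_comm]
  rw [badLocus]
  omega

theorem det_ne_zero_and_injective_of_badLocus {F : Type*} [Field F]
    {f : Fin r × Fin n → MvPolynomial (Fin r × Fin n) ℤ} {j₀ : Fin r} {y : Fin r × Fin n → F}
    (h : eval y (map (Int.castRingHom F) (badLocus f j₀)) ≠ 0) :
    (Matrix.of fun i j => eval y (pderiv j (map (Int.castRingHom F) (f i)))).det ≠ 0 ∧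
      Function.Injective fun i => y (j₀, i) := by
  rw [badLocus, map_mul, map_mul] at h
  constructor
  · have h1 := left_ne_zero_of_mul h
    rw [← RingHom.comp_apply, RingHom.map_det] at h1
    convert h1 using 2
    ext i j
    simp [pderiv_map]
  · have h1 := right_ne_zero_of_mul h
    simp only [map_prod, map_sub, map_X, eval_X] at h1
    have key : ∀ i i' : Fin n, i < i' → y (j₀, i) ≠ y (j₀, i') := by
      intro i i' hii h2
      refine h1 (Finset.prod_eq_zero (Finset.mem_univ i)
        (Finset.prod_eq_zero (Finset.mem_Ioi.2 hii) ?_))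
      rw [h2, sub_self]
    intro i i' h2
    rcases lt_trichotomy i i' with h3 | h3 | h3
    · exact absurd h2 (key i i' h3)
    · exact h3
    · exact absurd h2.symm (key i' i h3)

end BadLocus

/-! ### Many good points for each field -/

section Points

variable {k Ω : Type*} [Field k] [NumberField k] [Field Ω] [Algebra k Ω] [IsAlgClosure k Ω]
  {n r : ℕ} {K : IntermediateField k Ω}

theorem house_add_sum_zsmul_le {K : Type*} [Field K] [NumberField K] {m Q : ℕ} {l H₀ : ℝ}
    (a : 𝓞 K) (ha : house (a : K) ≤ H₀) (b : Fin m → 𝓞 K)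
    (hb : ∀ i, house (b i : K) ≤ l) (t : Fin m → ℤ) (ht : ∀ i, |(t i : ℝ)| ≤ Q / 2) :
    house ((a + ∑ i, t i • b i : 𝓞 K) : K) ≤ H₀ + m * (Q / 2 * l) := by
  have h1 : ((a + ∑ i, t i • b i : 𝓞 K) : K) = (a : K) + ∑ i, (t i : K) * (b i : K) := by
    simp [map_sum]
  rw [h1]
  refine (house_add_le _ _).trans (add_le_add ha ((house_sum_le_sum_house _ _).trans ?_))
  calc ∑ i, house ((t i : K) * (b i : K)) ≤ ∑ _i : Fin m, ((Q : ℝ) / 2 * l) := by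
        refine Finset.sum_le_sum fun i _ => (house_mul_le _ _).trans ?_
        rw [house_intCast, Int.cast_abs]
        exact mul_le_mul (ht i) (hb i) (house_nonneg _) (by positivity)
    _ = _ := by simp

/-- Many points of `(𝔸ⁿ)ʳ` from which `K` can be recovered and at which the invariants take
small values in `𝓞 k`. -/
theorem exists_finset_points [NumberField K] [FiniteDimensional k K] (hn : finrank k K = n)
    (hr : 1 ≤ r) {f : Fin r × Fin n → MvPolynomial (Fin r × Fin n) ℤ}
    (hf : AlgebraicIndependent ℤ f) {G : Subgroup (Equiv.Perm (Fin n))}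
    (hG : MulAction.IsPretransitive G (Fin n)) (hinv : ∀ i, IsInvariant G (f i))
    (hK : HasGaloisGroup G K) {l : ℝ} (hl : 1 ≤ l) (hKl : lambdaMax K ≤ l) (j₀ : Fin r)
    (i₀ : Fin n) {Q : ℕ} (hQ : Q = ∑ i, (f i).totalDegree + n.choose 2) :
    ∃ Y : Finset (Fin r × Fin n → Ω),
      (finrank ℚ K * Q * l / 2) ^ (finrank ℚ K * r) ≤
        Y.card * (Q : ℝ) ^ (finrank ℚ K * r) * √((|discr K| : ℤ) : ℝ) ^ r ∧
      ∀ y ∈ Y, IntermediateField.adjoin k {y (j₀, i₀)} = K ∧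
        (Matrix.of fun i j => MvPolynomial.eval y (MvPolynomial.pderiv j
          (MvPolynomial.map (Int.castRingHom Ω) (f i)))).det ≠ 0 ∧
        ∀ i, ∃ c : 𝓞 k, algebraMap k Ω (c : k) = MvPolynomial.aeval y (f i) ∧
          house (c : k) ≤ (MvPolynomial.eval (fun _ => (1 : ℤ)) (absPoly (f i)) : ℝ) *
            (finrank ℚ K * Q * l) ^ (f i).totalDegree := by
  classical
  have : CharZero Ω := charZero_of_injective_algebraMap (algebraMap k Ω).injective
  set m := finrank ℚ K with hm
  have hm0 : 0 < m := finrank_pos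
  have hfdeg := totalDegree_pos_of_algebraicIndependent hf
  have hn0 : 0 < n := Fin.pos i₀
  have hQdeg : (badLocus f j₀).totalDegree < Q := by
    have := totalDegree_badLocus_add_le hfdeg j₀
    have : 0 < n * r := Nat.mul_pos hn0 hr
    omega
  have hQ0 : 0 < Q := by omega
  obtain ⟨τ, hτ0, hτ, hτf⟩ := exists_embeddings (r := r) hG hK i₀
  obtain ⟨b, hb, hbspan⟩ := exists_fin_span_eq_top (span_house_le_eq_top_of_lambdaMax_le K hKl)
  -- Exactly `Q` consecutive integers, centred so that all are at most `Q / 2` in absolute value.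
  let I : Finset ℤ := Finset.Ico (-((Q / 2 : ℕ) : ℤ)) (Q - (Q / 2 : ℕ))
  have hIcard : I.card = Q := by simp [I]
  have hIabs : ∀ t ∈ I, |(t : ℝ)| ≤ Q / 2 := by
    intro t ht
    rw [Finset.mem_Ico] at ht
    have h1 : -(Q : ℤ) ≤ 2 * t := by omega
    have h2 : 2 * t ≤ Q := by omega
    have h1' : -(Q : ℝ) ≤ 2 * t := by exact_mod_cast h1
    have h2' : 2 * (t : ℝ) ≤ Q := by exact_mod_cast h2
    rw [abs_le]
    constructor <;> linarith
  let P := MvPolynomial.map (Int.castRingHom Ω) (badLocus f j₀)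
  have hP0 : P ≠ 0 := fun h => badLocus_ne_zero hf j₀
    (MvPolynomial.map_injective _ (RingHom.injective_int _) (by rw [map_zero]; exact h))
  have hPdeg : P.totalDegree < I.card := by
    rw [hIcard]
    exact (Finset.sup_mono (MvPolynomial.support_map_subset _ _)).trans_lt hQdeg
  choose t ht using fun a : Fin r → 𝓞 K =>
    exists_eval_conjPoint_ne_zero hτ (fun i => (b i : K)) hbspan hP0 (fun j => (a j : K)) I hPdeg
  let ψ : (Fin r → 𝓞 K) → Fin r → 𝓞 K := fun a j => a j + ∑ i, (t a (j, i) : ℤ) • b i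
  have hψ : ∀ a, (fun j => (ψ a j : K)) =
      fun j => (a j : K) + ∑ i, (t a (j, i) : ℤ) • (b i : K) := by
    intro a
    funext j
    simp [ψ, map_sum]
  let pt : (Fin r → 𝓞 K) → Fin r × Fin n → Ω := fun a => conjPoint τ fun j => (ψ a j : K)
  -- The perturbation has house at most `m · (Q/2) · l = H₀` as well, so perturbed tuples have house
  -- at most `2 H₀ = m Q l`.
  set H₀ : ℝ := m * Q * l / 2 with hH₀
  have hH₀0 : 0 < H₀ := by positivity
  have hfin := finite_house_le K H₀
  let A : Finset (Fin r → 𝓞 K) := Fintype.piFinset fun _ => hfin.toFinset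
  have hpt : ∀ a a', pt a = pt a' → ψ a = ψ a' := by
    intro a a' h
    funext j
    have h1 := congrFun h (j, i₀)
    simp only [pt, conjPoint, hτ0] at h1
    exact RingOfIntegers.coe_injective (K.val.injective h1)
  refine ⟨A.image pt, ?_, ?_⟩
  -- The `i₀` coordinates recover the perturbed tuple, and the perturbation `t` then recovers the
  -- original one; so a point has at most one preimage for each of the `Q ^ (m * r)` values of `t`.
  · have hcard : A.card ≤ Q ^ (m * r) * (A.image pt).card := by
      refine Finset.card_le_mul_card_image A _ fun y _ => ?_
      have h1 : Fintype.card (Fin r × Fin m → I) = Q ^ (m * r) := by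
        simp [hIcard, mul_comm]
      rw [← h1, ← Finset.card_univ]
      refine Finset.card_le_card_of_injOn t (fun _ _ => Finset.mem_coe.2 (Finset.mem_univ _)) ?_
      intro a ha a' ha' htt
      have hpp : pt a = pt a' := (Finset.mem_filter.1 ha).2.trans (Finset.mem_filter.1 ha').2.symm
      funext j
      have h2 := congrFun (hpt a a' hpp) j
      simp only [ψ, htt] at h2
      exact add_right_cancel h2
    have hAcard : A.card = {a : 𝓞 K | house (a : K) ≤ H₀}.ncard ^ r := by
      simp [A, ← Set.ncard_eq_toFinset_card _ hfin]
    have h2 := pow_le_pow_left₀ (by positivity) (pow_finrank_le_card_mul_sqrt_discr K hH₀0) r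
    rw [← pow_mul, mul_pow, ← Nat.cast_pow, ← hAcard] at h2
    refine h2.trans (mul_le_mul_of_nonneg_right ?_ (by positivity))
    rw [mul_comm]
    exact_mod_cast hcard
  · intro y hy
    obtain ⟨a, ha, rfl⟩ := Finset.mem_image.1 hy
    have hne : MvPolynomial.eval (pt a) P ≠ 0 := by
      simp only [pt, hψ]
      exact ht a
    obtain ⟨hdet, hinj⟩ := det_ne_zero_and_injective_of_badLocus hne
    refine ⟨?_, hdet, fun i => ?_⟩
    · have h1 := adjoin_eq_of_injective hn hτ (a := (ψ a j₀ : K)) hinj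
      have h2 : pt a (j₀, i₀) = ((ψ a j₀ : K) : Ω) := by
        simp only [pt, conjPoint, hτ0]
        rfl
      rw [h2]
      exact h1
    · obtain ⟨c, hc⟩ := hτf (f i) (hinv i) fun j => (ψ a j : K)
      have hH : ∀ j, house (ψ a j : K) ≤ m * Q * l := by
        intro j
        have h1 := house_add_sum_zsmul_le (Q := Q) (a j)
          (by simpa using Fintype.mem_piFinset.1 ha j) b hb (fun i => (t a (j, i) : ℤ))
          (fun i => hIabs _ (t a (j, i)).2)
        refine h1.trans (le_of_eq ?_)
        rw [hH₀]
        ring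
      have h1H : (1 : ℝ) ≤ m * Q * l := by
        have h1 : (1 : ℝ) ≤ m := by exact_mod_cast hm0
        have h2 : (1 : ℝ) ≤ Q := by exact_mod_cast hQ0
        exact one_le_mul_of_one_le_of_one_le (one_le_mul_of_one_le_of_one_le h1 h2) hl
      obtain ⟨hcint, hle⟩ := isIntegral_and_house_le τ (ψ a) h1H hH (f i) hc
      exact ⟨⟨c, hcint⟩, hc, hle⟩

end Points

end InvariantBound

namespace InvariantBound

open Module NumberField

/-! ### Comparison of the two counts and the final bounds -/

section Counting

variable {k Ω : Type*} [Field k] [NumberField k] [Field Ω] [Algebra k Ω] [IsAlgClosure k Ω]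
  {n r : ℕ}

/-- The number of nondegenerate points with values of the invariants in boxes of `𝓞 k`. -/
theorem card_points_le (f : Fin r × Fin n → MvPolynomial (Fin r × Fin n) ℤ)
    (hf : ∀ i, 0 < (f i).totalDegree) (B : Fin r × Fin n → ℝ) (Z : Finset (Fin r × Fin n → Ω))
    (hZ : ∀ y ∈ Z, (Matrix.of fun i j => MvPolynomial.eval y (MvPolynomial.pderiv j
        (MvPolynomial.map (Int.castRingHom Ω) (f i)))).det ≠ 0 ∧
      ∀ i, ∃ c : 𝓞 k, algebraMap k Ω (c : k) = MvPolynomial.aeval y (f i) ∧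
        house (c : k) ≤ B i) :
    Z.card ≤ (∏ i, (f i).totalDegree) * ∏ i, {a : 𝓞 k | house (a : k) ≤ B i}.ncard := by
  classical
  have : IsAlgClosed Ω := IsAlgClosure.isAlgClosed k
  have hfin := fun i => finite_house_le k (B i)
  have hc : ∀ y, ∃ c : Fin r × Fin n → 𝓞 k, y ∈ Z → ∀ i,
      algebraMap k Ω (c i : k) = MvPolynomial.aeval y (f i) ∧ house (c i : k) ≤ B i := by
    intro y
    by_cases hy : y ∈ Z
    · choose c hc using (hZ y hy).2
      exact ⟨c, fun _ => hc⟩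
    · exact ⟨fun _ => 0, fun h => absurd h hy⟩
  choose c hc using hc
  have hbox : ∏ i, {a : 𝓞 k | house (a : k) ≤ B i}.ncard =
      (Fintype.piFinset fun i => (hfin i).toFinset).card := by
    rw [Fintype.card_piFinset]
    exact Finset.prod_congr rfl fun i _ => Set.ncard_eq_toFinset_card _ (hfin i)
  rw [hbox, mul_comm]
  have himg : Z.image c ⊆ Fintype.piFinset fun i => (hfin i).toFinset := by
    intro w hw
    obtain ⟨y, hy, rfl⟩ := Finset.mem_image.1 hw
    exact Fintype.mem_piFinset.2 fun i => by simpa using (hc y hy i).2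
  refine le_trans ?_ (Nat.mul_le_mul_right _ (Finset.card_le_card himg))
  rw [mul_comm]
  refine Finset.card_le_mul_card_image Z _ fun w _ => ?_
  -- The points with value vector `w` are zeros of the system `f i - w i`, which has the same
  -- Jacobian as `f`.
  refine card_nondegenerate_zeros_le (fun i => MvPolynomial.map (Int.castRingHom Ω) (f i) -
    MvPolynomial.C (algebraMap k Ω (w i : k))) _ hf (fun i => ?_) _ (fun y hy i => ?_)
    (fun y hy => ?_)
  · exact (MvPolynomial.totalDegree_sub_C_le _ _).trans
      (Finset.sup_mono (MvPolynomial.support_map_subset _ _))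
  · obtain ⟨hyZ, rfl⟩ := Finset.mem_filter.1 hy
    rw [map_sub, MvPolynomial.eval_C, (hc y hyZ i).1, MvPolynomial.eval_map, sub_eq_zero]
    rfl
  · have := (hZ y (Finset.mem_filter.1 hy).1).1
    simpa using this

/-- From `d i ≤ 2 ^ (d i - 1)`. It absorbs the Bézout number into the power of `2` in the constant.
-/
theorem prod_le_two_pow {ι : Type*} [Fintype ι] (d : ι → ℕ) (hd : ∀ i, 0 < d i) :
    (∏ i, d i) * 2 ^ Fintype.card ι ≤ 2 ^ ∑ i, d i := by
  rw [← Finset.prod_pow_eq_pow_sum, ← Finset.card_univ, ← Finset.prod_const,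
    ← Finset.prod_mul_distrib]
  refine Finset.prod_le_prod' fun i _ => ?_
  obtain ⟨e, he⟩ : ∃ e, d i = e + 1 := ⟨d i - 1, by have := hd i; omega⟩
  rw [he, pow_succ]
  exact Nat.mul_le_mul_right _ Nat.lt_two_pow_self

/-- Comparison of the number of points with the number of fields. -/
theorem le_of_mul_le_of_mul_le {c z p I₁ s x l π₂ : ℝ} {d N D m Q r q : ℕ} (hs : 0 < s)
    (hl : 0 < l) (hm : 0 < m) (hQ : 0 < Q) (hd : 0 < d) (hND : N ≤ D) (hx : 0 ≤ x)
    (hI : 0 ≤ I₁) (hπ : 0 ≤ π₂) (hq : 1 ≤ q) (hp : p * 2 ^ N ≤ 2 ^ D)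
    (h1 : c * (m * Q * l / 2) ^ (d * N) ≤ z * (Q : ℝ) ^ (d * N) * x ^ r)
    (h2 : z * s ^ N ≤ p * (π₂ ^ (d * N) * (I₁ ^ d * (m * Q * l) ^ (d * D)))) :
    c ≤ π₂ ^ (d * N) * (q : ℝ) ^ N * I₁ ^ d * (2 * (m * Q : ℝ)) ^ (d * D) *
      (l ^ (d * D - d * N) * x ^ r / s ^ N) := by
  have hmr : (0 : ℝ) < m := by exact_mod_cast hm
  have hQr : (0 : ℝ) < Q := by exact_mod_cast hQ
  have hm1 : (1 : ℝ) ≤ m := by exact_mod_cast hm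
  have hq1 : (1 : ℝ) ≤ q := by exact_mod_cast hq
  obtain ⟨E, rfl⟩ := Nat.exists_eq_add_of_le hND
  have hsub : d * (N + E) - d * N = d * E := by rw [mul_add]; omega
  rw [hsub]
  -- The factor `2 ^ (d * N)` comes from the halved radius `m * Q * l / 2` of the starting box.
  have hp' : p * 2 ^ (d * N) ≤ 2 ^ (d * (N + E)) := by
    have h3 : p ≤ 2 ^ E := by
      rw [pow_add, mul_comm] at hp
      exact le_of_mul_le_mul_left hp (by positivity)
    calc p * 2 ^ (d * N) ≤ 2 ^ E * 2 ^ (d * N) := by gcongr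
      _ ≤ 2 ^ (d * E) * 2 ^ (d * N) := by
          gcongr
          · norm_num
          · exact Nat.le_mul_of_pos_left _ hd
      _ = _ := by rw [← pow_add]; congr 1; ring
  have hU : 0 < (m * Q * l / 2 : ℝ) ^ (d * N) * s ^ N := by positivity
  refine le_of_mul_le_mul_right ?_ hU
  calc c * ((m * Q * l / 2 : ℝ) ^ (d * N) * s ^ N)
      = (c * (m * Q * l / 2) ^ (d * N)) * s ^ N := by ring
    _ ≤ (z * (Q : ℝ) ^ (d * N) * x ^ r) * s ^ N := by gcongr
    _ = (z * s ^ N) * ((Q : ℝ) ^ (d * N) * x ^ r) := by ring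
    _ ≤ (p * (π₂ ^ (d * N) * (I₁ ^ d * (m * Q * l) ^ (d * (N + E))))) *
          ((Q : ℝ) ^ (d * N) * x ^ r) := by gcongr
    _ = (p * 2 ^ (d * N)) * ((Q : ℝ) ^ (d * N) * (1 / 2) ^ (d * N)) *
          (π₂ ^ (d * N) * I₁ ^ d * (m * Q * l) ^ (d * (N + E)) * x ^ r) := by
        have : (2 : ℝ) ^ (d * N) * (1 / 2) ^ (d * N) = 1 := by rw [← mul_pow]; norm_num
        linear_combination (-(p * (π₂ ^ (d * N) * (I₁ ^ d * (m * Q * l) ^ (d * (N + E)))) *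
          ((Q : ℝ) ^ (d * N) * x ^ r))) * this
    _ ≤ 2 ^ (d * (N + E)) * (((q : ℝ) ^ N * (m * Q : ℝ) ^ (d * N)) * (1 / 2) ^ (d * N)) *
          (π₂ ^ (d * N) * I₁ ^ d * (m * Q * l) ^ (d * (N + E)) * x ^ r) := by
        -- The factors `q ^ N` and `m ^ (d * N)` are slack, inserted to reach the stated form of the
        -- constant; `q` will be `d!`.
        gcongr
        rw [mul_pow, ← mul_assoc]
        refine le_mul_of_one_le_left (by positivity) ?_
        exact one_le_mul_of_one_le_of_one_le (one_le_pow₀ hq1) (one_le_pow₀ hm1)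
    _ = _ := by
        have e1 : (m * Q * l / 2 : ℝ) ^ (d * N) = (m * Q : ℝ) ^ (d * N) * l ^ (d * N) *
          (1 / 2) ^ (d * N) := by rw [← mul_pow, ← mul_pow]; congr 1; ring
        have e2 : (m * Q * l : ℝ) ^ (d * (N + E)) = (m * Q : ℝ) ^ (d * (N + E)) *
          (l ^ (d * E) * l ^ (d * N)) := by
          rw [← pow_add, mul_pow]; congr 2; ring
        have e3 : (2 * (m * Q : ℝ)) ^ (d * (N + E)) = 2 ^ (d * (N + E)) *
          (m * Q : ℝ) ^ (d * (N + E)) := mul_pow _ _ _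
        rw [e1, e2, e3]
        field_simp

theorem degSum_comp_equiv {τ ι ι' : Type*} [Fintype ι] [Fintype ι'] (e : ι' ≃ ι)
    (f : ι → MvPolynomial τ ℤ) : degSum (f ∘ e) = degSum f :=
  Equiv.sum_comp e fun i => (f i).totalDegree

theorem evalOne_comp_equiv {τ ι ι' : Type*} [Fintype ι] [Fintype ι'] (e : ι' ≃ ι)
    (f : ι → MvPolynomial τ ℤ) : evalOne (f ∘ e) = evalOne f :=
  Equiv.prod_comp e fun i => MvPolynomial.eval (fun _ => (1 : ℤ)) (absPoly (f i))

theorem card_extensions_le (hn : 1 ≤ n) (hr : 1 ≤ r)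
    (f : Fin (n * r) → MvPolynomial (Fin r × Fin n) ℤ) (hf : AlgebraicIndependent ℤ f)
    {G : Subgroup (Equiv.Perm (Fin n))} (hG : MulAction.IsPretransitive G (Fin n))
    (hinv : ∀ i, IsInvariant G (f i)) {d : ℕ} (hd : finrank ℚ k = d) {X : ℝ} (hX : 1 ≤ X)
    {l : ℝ} (hl : 1 ≤ l) (S : Finset (IntermediateField k Ω))
    (hS : ∀ K ∈ S, K ∈ extensionsMinimaLE k Ω G X l) :
    (S.card : ℝ) ≤ explicitConst n r d f *
      (l ^ ((d : ℝ) * (degSum f : ℝ) - (d : ℝ) * n * r) * X ^ ((r : ℝ) / 2) /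
        ((|discr k| : ℤ) : ℝ) ^ ((n : ℝ) * r / 2)) := by
  classical
  have hd0 : 0 < d := hd ▸ finrank_pos
  -- Indexing the invariants by the variables makes the Jacobian a square matrix.
  let e : Fin r × Fin n ≃ Fin (n * r) := Fintype.equivOfCardEq (by simp [mul_comm])
  have hg : AlgebraicIndependent ℤ (f ∘ e) := hf.comp e e.injective
  have hgdeg := totalDegree_pos_of_algebraicIndependent hg
  set g := f ∘ e
  have hD : ∑ i, (g i).totalDegree = degSum f := degSum_comp_equiv e f
  have hI : ∏ i, MvPolynomial.eval (fun _ => (1 : ℤ)) (absPoly (g i)) = evalOne f :=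
    evalOne_comp_equiv e f
  set Q := degSum f + n.choose 2 with hQ
  have hND : n * r ≤ degSum f := by
    rw [← hD]
    calc n * r = ∑ _i : Fin r × Fin n, 1 := by simp [mul_comm]
      _ ≤ _ := Finset.sum_le_sum fun i _ => hgdeg i
  have hN0 : 0 < n * r := Nat.mul_pos hn hr
  have hQ0 : 0 < Q := by omega
  have hE1 : ∀ i, (1 : ℝ) ≤ (MvPolynomial.eval (fun _ => (1 : ℤ)) (absPoly (g i)) : ℤ) := fun i => by
    exact_mod_cast one_le_eval_one_absPoly (hg.ne_zero i)
  have hI0 : (0 : ℝ) ≤ evalOne f := by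
    rw [← hI, Int.cast_prod]
    exact Finset.prod_nonneg fun i _ => zero_le_one.trans (hE1 i)
  have hs : 0 < √((|discr k| : ℤ) : ℝ) := by
    rw [Real.sqrt_pos]
    exact_mod_cast abs_pos.2 (discr_ne_zero k)
  have hDk0 : (0 : ℝ) ≤ ((|discr k| : ℤ) : ℝ) := by positivity
  have hrw : explicitConst n r d f *
      (l ^ ((d : ℝ) * (degSum f : ℝ) - (d : ℝ) * n * r) * X ^ ((r : ℝ) / 2) /
        ((|discr k| : ℤ) : ℝ) ^ ((n : ℝ) * r / 2)) =
      (2 * Real.pi) ^ (d * (n * r)) * (d.factorial : ℝ) ^ (n * r) * (evalOne f : ℝ) ^ d *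
        (2 * ((d * n : ℕ) * (Q : ℕ) : ℝ)) ^ (d * degSum f) *
      (l ^ (d * degSum f - d * (n * r)) * √X ^ r / √((|discr k| : ℤ) : ℝ) ^ (n * r)) := by
    have e1 : l ^ ((d : ℝ) * (degSum f : ℝ) - (d : ℝ) * n * r) =
        l ^ (d * degSum f - d * (n * r)) := by
      rw [← Real.rpow_natCast, Nat.cast_sub (Nat.mul_le_mul_left _ hND)]
      congr 1
      push_cast
      ring
    have e2 : X ^ ((r : ℝ) / 2) = √X ^ r := by
      rw [Real.sqrt_eq_rpow, ← Real.rpow_natCast, ← Real.rpow_mul (by linarith)]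
      congr 1
      ring
    have e3 : ((|discr k| : ℤ) : ℝ) ^ ((n : ℝ) * r / 2) = √((|discr k| : ℤ) : ℝ) ^ (n * r) := by
      rw [Real.sqrt_eq_rpow, ← Real.rpow_natCast, ← Real.rpow_mul hDk0]
      congr 1
      push_cast
      ring
    rw [e1, e2, e3, explicitConst, mul_assoc d n r]
    congr 3
    rw [hQ]
    push_cast
    ring
  rw [hrw]
  rcases S.eq_empty_or_nonempty with rfl | ⟨K₀, hK₀⟩
  · simp only [Finset.card_empty, Nat.cast_zero]
    positivity
  let j₀ : Fin r := ⟨0, hr⟩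
  let i₀ : Fin n := ⟨0, hn⟩
  have hpts : ∀ K : IntermediateField k Ω, ∃ Y : Finset (Fin r × Fin n → Ω), K ∈ S →
      ((d * n : ℕ) * Q * l / 2) ^ (d * (n * r)) ≤
        Y.card * (Q : ℝ) ^ (d * (n * r)) * √X ^ r ∧
      ∀ y ∈ Y, IntermediateField.adjoin k {y (j₀, i₀)} = K ∧
        (Matrix.of fun i j => MvPolynomial.eval y (MvPolynomial.pderiv j
          (MvPolynomial.map (Int.castRingHom Ω) (g i)))).det ≠ 0 ∧
        ∀ i, ∃ c : 𝓞 k, algebraMap k Ω (c : k) = MvPolynomial.aeval y (g i) ∧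
          house (c : k) ≤ (MvPolynomial.eval (fun _ => (1 : ℤ)) (absPoly (g i)) : ℝ) *
            ((d * n : ℕ) * Q * l) ^ (g i).totalDegree := by
    intro K
    by_cases hK : K ∈ S
    · obtain ⟨⟨hfr, hgal, _, hdisc⟩, hnf, hlam⟩ := hS K hK
      have hfd : FiniteDimensional k K := FiniteDimensional.of_finrank_pos (by omega)
      have hfrQ : finrank ℚ K = d * n := by
        rw [← finrank_mul_finrank ℚ k K, hd, hfr]
      obtain ⟨Y, hY1, hY2⟩ := exists_finset_points (l := l) (Q := Q) hfr hr hg hG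
        (fun i => hinv (e i)) hgal hl hlam j₀ i₀ (by rw [hQ, hD])
      rw [hfrQ] at hY1 hY2
      rw [mul_assoc d n r] at hY1
      refine ⟨Y, fun _ => ⟨hY1.trans ?_, hY2⟩⟩
      gcongr
    · exact ⟨∅, fun h => absurd h hK⟩
  choose Y hY using hpts
  set H : ℝ := (d * n : ℕ) * Q * l with hH
  let B : Fin r × Fin n → ℝ := fun i =>
    (MvPolynomial.eval (fun _ => (1 : ℤ)) (absPoly (g i)) : ℝ) * H ^ (g i).totalDegree
  have hdn1 : (1 : ℝ) ≤ (d * n : ℕ) := by exact_mod_cast Nat.mul_pos hd0 hn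
  have hQ1 : (1 : ℝ) ≤ Q := by exact_mod_cast hQ0
  have hH1 : 1 ≤ H :=
    one_le_mul_of_one_le_of_one_le (one_le_mul_of_one_le_of_one_le hdn1 hQ1) hl
  -- The coordinate `(j₀, i₀)` of a point generates its field over `k`.
  have hdisj : (S : Set (IntermediateField k Ω)).PairwiseDisjoint Y := by
    intro K hK K' hK' hne
    refine Finset.disjoint_left.2 fun y hy hy' => hne ?_
    rw [← ((hY K hK).2 y hy).1, ← ((hY K' hK').2 y hy').1]
  have hZ := card_points_le (k := k) g hgdeg B (S.biUnion Y) (by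
    intro y hy
    obtain ⟨K, hK, hyK⟩ := Finset.mem_biUnion.1 hy
    exact ((hY K hK).2 y hyK).2)
  rw [Finset.card_biUnion hdisj] at hZ
  have hbox : ∀ i, {a : 𝓞 k | house (a : k) ≤ B i}.ncard * √((|discr k| : ℤ) : ℝ) ≤
      (2 * Real.pi) ^ d * B i ^ d := by
    -- A single field of the family suffices to show that `𝓞 k` is spanned by elements of house at
    -- most `n * l`.
    obtain ⟨⟨hfr, -, -⟩, hnf, hlam⟩ := hS K₀ hK₀
    have hspan := span_house_le_mul_finrank_eq_top (k := k)
      (span_house_le_eq_top_of_lambdaMax_le K₀ hlam)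
    rw [hfr] at hspan
    intro i
    -- Each box is at least as large as `H ≥ d * n * l`, as the lattice point count requires; this
    -- uses `deg f_i ≥ 1` and `|f_i|(1) ≥ 1`.
    have hHB : H ≤ B i := by
      calc H = 1 * H ^ 1 := by ring
        _ ≤ _ := mul_le_mul (hE1 i) (pow_le_pow_right₀ hH1 (hgdeg i)) (by positivity)
          (zero_le_one.trans (hE1 i))
    have := card_mul_sqrt_discr_le k hspan (R := B i) (by linarith) (by
      refine le_trans ?_ hHB
      rw [hd, hH]
      push_cast
      rw [← mul_assoc]
      refine mul_le_mul_of_nonneg_right ?_ (by linarith)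
      exact le_mul_of_one_le_right (by positivity) hQ1)
    rwa [hd] at this
  have hcardσ : Fintype.card (Fin r × Fin n) = n * r := by simp [mul_comm]
  refine le_of_mul_le_of_mul_le (z := ((∑ K ∈ S, (Y K).card : ℕ) : ℝ))
    (p := ((∏ i, (g i).totalDegree : ℕ) : ℝ)) hs (by linarith) (Nat.mul_pos hd0 hn) hQ0 hd0 hND
    (Real.sqrt_nonneg _) hI0 (by positivity) (Nat.one_le_iff_ne_zero.2 d.factorial_ne_zero) ?_ ?_ ?_
  · have := prod_le_two_pow (fun i => (g i).totalDegree) hgdeg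
    rw [hcardσ, hD] at this
    exact_mod_cast this
  · rw [Nat.cast_sum, Finset.sum_mul, Finset.sum_mul, ← nsmul_eq_mul]
    exact Finset.card_nsmul_le_sum _ _ _ fun K hK => (hY K hK).1
  · have hB0 : ∀ i, 0 ≤ B i := fun i =>
      mul_nonneg (zero_le_one.trans (hE1 i)) (by positivity)
    calc ((∑ K ∈ S, (Y K).card : ℕ) : ℝ) * √((|discr k| : ℤ) : ℝ) ^ (n * r)
        ≤ (((∏ i, (g i).totalDegree) * ∏ i, {a : 𝓞 k | house (a : k) ≤ B i}.ncard : ℕ) : ℝ) *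
            √((|discr k| : ℤ) : ℝ) ^ (n * r) := by
          gcongr
      _ = ((∏ i, (g i).totalDegree : ℕ) : ℝ) *
            ∏ i, ({a : 𝓞 k | house (a : k) ≤ B i}.ncard * √((|discr k| : ℤ) : ℝ)) := by
          rw [Finset.prod_mul_distrib, Finset.prod_const, Finset.card_univ, hcardσ]
          push_cast
          ring
      _ ≤ ((∏ i, (g i).totalDegree : ℕ) : ℝ) * ∏ i, ((2 * Real.pi) ^ d * B i ^ d) := by
          refine mul_le_mul_of_nonneg_left ?_ (by positivity)
          exact Finset.prod_le_prod (fun i _ => by positivity) fun i _ => hbox i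
      _ = _ := by
          congr 1
          rw [Finset.prod_mul_distrib, Finset.prod_const, Finset.card_univ, hcardσ, ← pow_mul,
            Finset.prod_pow, Finset.prod_mul_distrib, Finset.prod_pow_eq_pow_sum, hD,
            mul_pow _ (H ^ _), ← pow_mul H, ← hI, Int.cast_prod, mul_comm (degSum f) d]

/-- A uniform bound on finite subfamilies yields finiteness too, so finiteness of the set of fields
need not be known beforehand. -/
theorem finite_and_ncard_le_of_forall_finset {α : Type*} {s : Set α} {C : ℝ}
    (h : ∀ S : Finset α, (∀ x ∈ S, x ∈ s) → (S.card : ℝ) ≤ C) :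
    s.Finite ∧ (s.ncard : ℝ) ≤ C := by
  have hfin : s.Finite := by
    by_contra hinf
    obtain ⟨S, hS, hcard⟩ := Set.Infinite.exists_subset_card_eq hinf (⌊C⌋₊ + 1)
    have h1 := h S hS
    rw [hcard] at h1
    push_cast at h1
    linarith [Nat.lt_floor_add_one C]
  refine ⟨hfin, ?_⟩
  rw [Set.ncard_eq_toFinset_card s hfin]
  exact h _ (by simp)

theorem extensionsMinimaLE_finite_and_ncard_le (hn : 1 ≤ n) (hr : 1 ≤ r)
    (f : Fin (n * r) → MvPolynomial (Fin r × Fin n) ℤ) (hf : AlgebraicIndependent ℤ f)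
    {G : Subgroup (Equiv.Perm (Fin n))} (hG : MulAction.IsPretransitive G (Fin n))
    (hinv : ∀ i, IsInvariant G (f i)) {d : ℕ} (hd : finrank ℚ k = d) {X : ℝ} (hX : 1 ≤ X)
    {l : ℝ} (hl : 1 ≤ l) :
    (extensionsMinimaLE k Ω G X l).Finite ∧ ((extensionsMinimaLE k Ω G X l).ncard : ℝ) ≤
      explicitConst n r d f *
      (l ^ ((d : ℝ) * (degSum f : ℝ) - (d : ℝ) * n * r) * X ^ ((r : ℝ) / 2) /
        ((|discr k| : ℤ) : ℝ) ^ ((n : ℝ) * r / 2)) :=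
  finite_and_ncard_le_of_forall_finset fun S hS =>
    card_extensions_le hn hr f hf hG hinv hd hX hl S hS

theorem extensions_subset_extensionsMinimaLE {G : Subgroup (Equiv.Perm (Fin n))} {d : ℕ}
    (hd : finrank ℚ k = d) (hn : 1 ≤ n) (X : ℝ) :
    extensions k Ω G X ⊆ extensionsMinimaLE k Ω G X (X ^ ((1 : ℝ) / (d * n : ℕ))) := by
  intro K hK
  refine ⟨hK, ?_⟩
  obtain ⟨hfr, -, hnf, hdisc⟩ := hK
  refine ⟨hnf, ?_⟩
  have hd0 : 0 < d := hd ▸ finrank_pos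
  have hfrQ : finrank ℚ K = d * n := by
    have hfd : FiniteDimensional k K := FiniteDimensional.of_finrank_pos (by omega)
    rw [← finrank_mul_finrank ℚ k K, hd, hfr]
  have h1 := (lambdaMax_pow_le_discr K).trans hdisc
  rw [hfrQ] at h1
  have h0 : 0 ≤ lambdaMax K := Real.sInf_nonneg fun t ht => ht.1
  have hne : d * n ≠ 0 := (Nat.mul_pos hd0 hn).ne'
  rw [one_div]
  calc lambdaMax K = (lambdaMax K ^ (d * n)) ^ (((d * n : ℕ) : ℝ)⁻¹) :=
        (Real.pow_rpow_inv_natCast h0 hne).symm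
    _ ≤ _ := Real.rpow_le_rpow (by positivity) h1 (by positivity)

theorem extensions_finite_and_ncard_le (hn : 1 ≤ n) (hr : 1 ≤ r)
    (f : Fin (n * r) → MvPolynomial (Fin r × Fin n) ℤ) (hf : AlgebraicIndependent ℤ f)
    {G : Subgroup (Equiv.Perm (Fin n))} (hG : MulAction.IsPretransitive G (Fin n))
    (hinv : ∀ i, IsInvariant G (f i)) {d : ℕ} (hd : finrank ℚ k = d) {X : ℝ} (hX : 1 ≤ X) :
    (extensions k Ω G X).Finite ∧ ((extensions k Ω G X).ncard : ℝ) ≤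
      explicitConst n r d f * (X ^ ((degSum f : ℝ) / n - (r : ℝ) / 2) /
        ((|discr k| : ℤ) : ℝ) ^ ((r : ℝ) * n / 2)) := by
  have hd0 : 0 < d := hd ▸ finrank_pos
  have hsub := extensions_subset_extensionsMinimaLE (Ω := Ω) (G := G) hd hn X
  have hl : 1 ≤ X ^ ((1 : ℝ) / (d * n : ℕ)) := Real.one_le_rpow hX (by positivity)
  obtain ⟨hfin, hcard⟩ := extensionsMinimaLE_finite_and_ncard_le (k := k) (Ω := Ω) hn hr f hf hG
    hinv hd hX hl
  refine ⟨hfin.subset hsub, ?_⟩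
  have h1 : ((extensions k Ω G X).ncard : ℝ) ≤ (extensionsMinimaLE k Ω G X
      (X ^ ((1 : ℝ) / (d * n : ℕ)))).ncard := by exact_mod_cast Set.ncard_le_ncard hsub hfin
  refine (h1.trans hcard).trans (le_of_eq ?_)
  have hX0 : 0 < X := by linarith
  have hdr : (d : ℝ) ≠ 0 := by exact_mod_cast hd0.ne'
  have hnr : (n : ℝ) ≠ 0 := by exact_mod_cast (show n ≠ 0 by omega)
  -- The exponent of `X` becomes `(d deg 𝓘 - dnr)/(dn) + r/2 = deg 𝓘 / n - r/2`.
  rw [← Real.rpow_mul hX0.le, ← Real.rpow_add hX0, mul_comm (r : ℝ) n]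
  congr 3
  push_cast
  field_simp
  ring

theorem explicitConst_pos {f : Fin (n * r) → MvPolynomial (Fin r × Fin n) ℤ} (hn : 1 ≤ n)
    (hr : 1 ≤ r) (hf : AlgebraicIndependent ℤ f) {d : ℕ} (hd : 0 < d) :
    0 < explicitConst n r d f := by
  have hI : (0 : ℝ) < evalOne f := by
    have : 0 < evalOne f := Finset.prod_pos fun i _ =>
      zero_lt_one.trans_le (one_le_eval_one_absPoly (hf.ne_zero i))
    exact_mod_cast this
  have hD : 0 < degSum f := Finset.sum_pos
    (fun i _ => totalDegree_pos_of_algebraicIndependent hf i)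
    ⟨⟨0, Nat.mul_pos hn hr⟩, Finset.mem_univ _⟩
  have hD' : (0 : ℝ) < degSum f := by exact_mod_cast hD
  unfold explicitConst
  positivity

end Counting

end InvariantBound

end
theorem theorem3p1 (n r : ℕ) (hn : 1 ≤ n) (hr : 1 ≤ r)
    (f : Fin (n * r) → MvPolynomial (Fin r × Fin n) ℤ) (hf : AlgebraicIndependent ℤ f) :
    -- the bound with an implied constant depending only on `n`, `r`, `f` and `d = [k : ℚ]`
    (∀ d : ℕ, ∃ C : ℝ, 0 < C ∧
      ∀ (G : Subgroup (Equiv.Perm (Fin n))), MulAction.IsPretransitive G (Fin n) →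
      (∀ i, InvariantBound.IsInvariant G (f i)) →
      ∀ (k Ω : Type*) [Field k] [NumberField k] [Field Ω] [Algebra k Ω] [IsAlgClosure k Ω],
      Module.finrank ℚ k = d → ∀ X : ℝ, 1 ≤ X →
        (InvariantBound.extensions k Ω G X).Finite ∧
        ((InvariantBound.extensions k Ω G X).ncard : ℝ) ≤
          C * X ^ ((InvariantBound.degSum f : ℝ) / n - (r : ℝ) / 2) *
            ((|NumberField.discr k| : ℤ) : ℝ) ^ (-((n : ℝ) * r / 2))) ∧
    -- the explicit bounds, the first one for the fields with `λ_max(K) ≤ l`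
    (∀ (G : Subgroup (Equiv.Perm (Fin n))), MulAction.IsPretransitive G (Fin n) →
      (∀ i, InvariantBound.IsInvariant G (f i)) →
      ∀ (k Ω : Type*) [Field k] [NumberField k] [Field Ω] [Algebra k Ω] [IsAlgClosure k Ω],
      ∀ d : ℕ, Module.finrank ℚ k = d → ∀ X : ℝ, 1 ≤ X →
        (∀ l : ℝ, 1 ≤ l →
          (InvariantBound.extensionsMinimaLE k Ω G X l).Finite ∧
          ((InvariantBound.extensionsMinimaLE k Ω G X l).ncard : ℝ) ≤
            InvariantBound.explicitConst n r d f *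
              (l ^ ((d : ℝ) * (InvariantBound.degSum f : ℝ) - (d : ℝ) * n * r) *
                  X ^ ((r : ℝ) / 2) /
                ((|NumberField.discr k| : ℤ) : ℝ) ^ ((n : ℝ) * r / 2))) ∧
        (InvariantBound.extensions k Ω G X).Finite ∧
        ((InvariantBound.extensions k Ω G X).ncard : ℝ) ≤
          InvariantBound.explicitConst n r d f *
            (X ^ ((InvariantBound.degSum f : ℝ) / n - (r : ℝ) / 2) /
              ((|NumberField.discr k| : ℤ) : ℝ) ^ ((r : ℝ) * n / 2))) := by
  refine ⟨fun d => ?_, ?_⟩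
  · rcases Nat.eq_zero_or_pos d with rfl | hd0
    -- No number field has degree `0`, so any positive constant serves.
    · refine ⟨1, one_pos, ?_⟩
      intro G _ _ k Ω _ _ _ _ _ hd
      exact absurd hd Module.finrank_pos.ne'
    · refine ⟨InvariantBound.explicitConst n r d f,
        InvariantBound.explicitConst_pos hn hr hf hd0, ?_⟩
      intro G hG hinv k Ω _ _ _ _ _ hd X hX
      obtain ⟨h1, h2⟩ := InvariantBound.extensions_finite_and_ncard_le (k := k) (Ω := Ω) hn hr f
        hf hG hinv hd hX
      refine ⟨h1, h2.trans (le_of_eq ?_)⟩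
      rw [Real.rpow_neg (by positivity), mul_comm (r : ℝ) n]
      ring
  · intro G hG hinv k Ω _ _ _ _ _ d hd X hX
    exact ⟨fun l hl => InvariantBound.extensionsMinimaLE_finite_and_ncard_le hn hr f hf hG hinv hd
      hX hl, InvariantBound.extensions_finite_and_ncard_le hn hr f hf hG hinv hd hX⟩
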